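/- Let $G$ be an unweighted directed acyclic graph with vertices $v_1,\dots,v_n$ ($n\ge 1$) and $m$ edges, given by the lists of out-neighbours of its vertices, and let $\hat n$ be the number of vertices with at least one outgoing edge (non-sinks). Let $\mathrm{len}(i,j)$ be the length of a shortest directed path from $v_i$ to $v_j$, or $-1$ if there is none, and let $\mathrm{diam}(G)=\max_{i,j}\mathrm{len}(i,j)$. Let $Q$ be the Dürr–Høyer quantum algorithm for the minimum of $N\ge 1$ numbers, that is: start with a uniformly random item as threshold; repeatedly search for an item below the threshold by the exponential Grover search (parameter $\mu=1$ at first; apply a uniformly random number $j\in\{0,1,\dots\}$, $j<\mu$, of Grover iterations to the uniform superposition, measure and compare; after a failure replace $\mu$ by $\min(\tfrac65\mu,\sqrt N)$), making every item found the new threshold and restarting with $\mu=1$; interrupt when the time used exceeds $22.5\sqrt N+1.4\log_2^2N$; return the threshold. One Grover iteration and one comparison take unit time each, and the start of each search takes $\lceil\log_2 N\rceil$. Let $\hat Q$ return the least result of $\lceil 2\log_2 n\rceil$ independent runs of $Q$ (and $+\infty$ on the empty list). Consider the following algorithm. Number the vertices so that every edge leads from a smaller to a larger number and the sinks come last (if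 the given numbering is not of this kind, by a classical topological sort), and set up the lists $D'_i$ of in-neighbours. Put $max\_len=-\infty$. For $z=\hat n,\dots,1$: set $t^z[z]=0$ and all other entries of $t^z$ to $+\infty$; for $i=z+1,\dots,n$, set $t^z[i]=\hat Q\big(t^z[j]: v_j\in D'_i\big)+1$, and if $t^z[i]$ is finite and exceeds $max\_len$, set $max\_len=t^z[i]$. Return $max\_len$ (or $0$ if it is still $-\infty$). There is an absolute constant $C$ such that for every such $G$ the algorithm returns a value different from $\mathrm{diam}(G)$ with probability at most $C/n$, and, if $G$ has at least one edge, its expected running time is at most $C\,\hat n\,(n+\sqrt{nm})\log n$. That is, it solves the diameter search problem with expected running time $O(\hat n(n+\sqrt{nm})\log n)$ and error probability $O(1/n)$. -/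

import Mathlib

open scoped ENNReal

noncomputable section

namespace DagDiameter

/-! ### Graphs given by adjacency lists -/

/-- A directed graph on the vertices `0, …, n - 1`, given by the lists `out v` of out-neighbours
(the lists `D_v` of the adjacency list model). -/
structure AdjGraph (n : ℕ) where
  out : Fin n → List (Fin n)
  nodup : ∀ v, (out v).Nodup

namespace AdjGraph

variable {n : ℕ} (G : AdjGraph n)

/-- `G.HasPath i j k`: there is a directed path with `k` edges from `i` to `j`. -/
inductive HasPath (G : AdjGraph n) : Fin n → Fin n → ℕ → Prop
  | nil (i : Fin n) : HasPath G i i 0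
  | cons {i u j : Fin n} {k : ℕ} : u ∈ G.out i → HasPath G u j k → HasPath G i j (k + 1)

/-- No path of positive length starts and finishes in the same vertex. -/
def Acyclic : Prop := ∀ (v : Fin n) (k : ℕ), G.HasPath v v k → k = 0

/-- The number `m` of edges. -/
def numEdges : ℕ := ∑ v, (G.out v).length

/-- The number of vertices with at least one outgoing edge (the non-sinks). -/
def numNonSinks : ℕ := (Finset.univ.filter fun v => G.out v ≠ []).card

/-- The list of in-neighbours of `v`. -/
def inList (v : Fin n) : List (Fin n) := (List.finRange n).filter fun u => v ∈ G.out u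

/-- Every edge goes from a smaller to a larger vertex, and the sinks are the last vertices. -/
def Ordered : Prop :=
  (∀ u v, v ∈ G.out u → u < v) ∧ ∀ v : Fin n, G.numNonSinks ≤ (v : ℕ) → G.out v = []

open Classical in
/-- The length of a shortest path from `i` to `j`, and `-1` if there is no path. -/
def len (i j : Fin n) : ℤ :=
  if h : ∃ k, G.HasPath i j k then (Nat.find h : ℤ) else -1

/-- The diameter: the maximum of `len i j` over all pairs of vertices. -/
def diam [NeZero n] : ℤ :=
  (Finset.univ : Finset (Fin n × Fin n)).sup' Finset.univ_nonempty fun p => G.len p.1 p.2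

end AdjGraph

/-! ### Randomized computations with a clock -/

/-- A randomized computation: the joint law of its result and its running time. -/
def Timed (α : Type) : Type := PMF (α × ℕ)

namespace Timed

/-- The underlying law on pairs (result, running time). -/
def law {α : Type} (p : Timed α) : PMF (α × ℕ) := p

/-- Return a value in no time. -/
protected def pure {α : Type} (a : α) : Timed α := PMF.pure (a, 0)

/-- Run one computation after another, with fresh randomness; the running times add up. -/
protected def bind {α β : Type} (p : Timed α) (f : α → Timed β) : Timed β :=
  p.law.bind fun a => (f a.1).law.map fun b => (b.1, a.2 + b.2)

instance : Monad Timed where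
  pure := Timed.pure
  bind := Timed.bind

/-- Spend `k` time steps. -/
def tick (k : ℕ) : Timed Unit := (PMF.pure ((), k) : PMF (Unit × ℕ))

/-- Sample from a distribution in no time. -/
def sample {α : Type} (p : PMF α) : Timed α := (p.map fun a => (a, 0) : PMF (α × ℕ))

/-- The probability that the result satisfies `P`. -/
def prob {α : Type} (p : Timed α) (P : α → Prop) : ℝ≥0∞ := p.law.toOuterMeasure {a | P a.1}

/-- The expected running time. -/
def expectedTime {α : Type} (p : Timed α) : ℝ≥0∞ := ∑' a : α × ℕ, p.law a * (a.2 : ℝ≥0∞)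

end Timed

/-! ### Grover iterations on an index register -/

/-- The state space of a quantum register holding an index `j < N`. -/
abbrev Register (N : ℕ) : Type := EuclideanSpace ℂ (Fin N)

/-- The uniform superposition of all indices. -/
def uniformState (N : ℕ) : Register N := WithLp.toLp 2 fun _ => (1 / (Real.sqrt N : ℂ))

open Classical in
/-- The oracle unitary: it changes the sign of every marked basis state. -/
def phaseOracle {N : ℕ} (marked : Fin N → Prop) : Register N ≃ₗᵢ[ℂ] Register N :=
  LinearIsometryEquiv.piLpCongrRight 2 fun j =>
    if marked j then LinearIsometryEquiv.neg ℂ else LinearIsometryEquiv.refl ℂ ℂ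

/-- The diffusion unitary `2 |s⟩⟨s| - 1`, where `s` is the uniform superposition. -/
def diffusion (N : ℕ) : Register N ≃ₗᵢ[ℂ] Register N :=
  (Submodule.span ℂ {uniformState N}).reflection

/-- One Grover iteration: the oracle, and then the diffusion. -/
def groverStep {N : ℕ} (marked : Fin N → Prop) : Register N ≃ₗᵢ[ℂ] Register N :=
  (phaseOracle marked).trans (diffusion N)

/-- The state after `j` Grover iterations, started in the uniform superposition. -/
def groverState {N : ℕ} (marked : Fin N → Prop) (j : ℕ) : Register N :=
  (groverStep marked)^[j] (uniformState N)

theorem norm_uniformState (N : ℕ) [NeZero N] : ‖uniformState N‖ = 1 := by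
  have hN : (0 : ℝ) < N := Nat.cast_pos.2 (Nat.pos_of_neZero N)
  rw [EuclideanSpace.norm_eq, Real.sqrt_eq_one]
  simp [uniformState, abs_of_nonneg (Real.sqrt_nonneg _), Real.sq_sqrt hN.le, hN.ne']

theorem norm_groverState {N : ℕ} [NeZero N] (marked : Fin N → Prop) (j : ℕ) :
    ‖groverState marked j‖ = 1 := by
  induction j with
  | zero => exact norm_uniformState N
  | succ j ih =>
    rw [groverState, Function.iterate_succ_apply', LinearIsometryEquiv.norm_map]
    exact ih

/-- The outcome of measuring a unit vector in the computational basis (Born's rule). -/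
def born {N : ℕ} (ψ : Register N) (hψ : ‖ψ‖ = 1) : PMF (Fin N) :=
  PMF.ofFintype (fun j => ENNReal.ofReal (‖ψ j‖ ^ 2)) (by
    rw [← ENNReal.ofReal_sum_of_nonneg fun _ _ => by positivity,
      ← EuclideanSpace.norm_sq_eq, hψ]
    simp)

/-! ### The Dürr–Høyer minimum search and its boosted version -/

/-- The time after which the Dürr–Høyer search over `N` items is interrupted. -/
def cutoff (N : ℕ) : ℝ := 22.5 * Real.sqrt N + 1.4 * Real.logb 2 N ^ 2

/-- The number of Grover iterations in one round of the exponential search: for a real `m ≥ 1`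
it is uniform among the nonnegative integers smaller than `m`. -/
def iterationCount (m : ℝ) : PMF ℕ :=
  (PMF.uniformOfFintype (Fin (⌈m⌉₊ - 1 + 1))).map fun j => (j : ℕ)

open Classical in
/-- The main loop of the Dürr–Høyer search in the table `x`. The current threshold index is `y`,
the current parameter of the exponential search is `m`, and `elapsed` is the time used so far.
In every round `j < m` is drawn at random, `j` Grover iterations that mark the items below the
threshold are applied to the uniform superposition, the register is measured, and the outcome is
compared with the threshold. A better item becomes the new threshold and the exponential search
starts again with `m = 1`; otherwise `m` grows to `min (6 / 5 * m) √N`. A Grover iteration (one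
oracle application) and the comparison take one time step each, the start of a new exponential
search takes `⌈log₂ N⌉` steps. The loop is interrupted once `elapsed` exceeds the cutoff.

The first argument only bounds the number of rounds. As every round takes at least one time step,
`⌊cutoff N⌋ + 1` rounds always suffice to pass the cutoff. -/
def minSearchLoop {N : ℕ} [NeZero N] (x : Fin N → ℕ∞) :
    ℕ → Fin N → ℝ → ℕ → Timed (Fin N)
  | 0, y, _, _ => pure y
  | rounds + 1, y, m, elapsed =>
    if cutoff N < elapsed then pure y
    else do
      let j ← Timed.sample (iterationCount m)
      let i ← Timed.sample
        (born (groverState (fun i => x i < x y) j) (norm_groverState _ j))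
      Timed.tick (j + 1)
      if x i < x y then do
        Timed.tick (Nat.clog 2 N)
        minSearchLoop x rounds i 1 (elapsed + (j + 1) + Nat.clog 2 N)
      else
        minSearchLoop x rounds y (min (6 / 5 * m) (Real.sqrt N)) (elapsed + (j + 1))

/-- The Dürr–Høyer quantum algorithm `Q` for `MIN`: the first threshold index is uniform,
and the value at the last threshold index is returned. -/
def minSearch {N : ℕ} [NeZero N] (x : Fin N → ℕ∞) : Timed ℕ∞ := do
  let y ← Timed.sample (PMF.uniformOfFintype (Fin N))
  Timed.tick (Nat.clog 2 N + 1)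
  let y' ← minSearchLoop x (⌊cutoff N⌋₊ + 1) y 1 (Nat.clog 2 N)
  pure (x y')

/-- The boosted version of `Q`: the least result of `k` independent runs. -/
def boostedMinSearch {N : ℕ} [NeZero N] (x : Fin N → ℕ∞) : ℕ → Timed ℕ∞
  | 0 => pure ⊤
  | k + 1 => do
    let a ← minSearch x
    let b ← boostedMinSearch x k
    Timed.tick 1
    pure (min a b)

open Classical in
/-- The boosted minimum search with `k` runs on a list of values. The minimum of the empty list
is `+∞`, found in one step. -/
def boostedMin (k : ℕ) (l : List ℕ∞) : Timed ℕ∞ :=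
  if h : l = [] then do
    Timed.tick 1
    pure ⊤
  else
    haveI : NeZero l.length := ⟨fun h0 => h (List.length_eq_zero_iff.1 h0)⟩
    boostedMinSearch (fun j => l.get j) k

/-! ### The diameter algorithm -/

section Algorithm

variable {n : ℕ} (G : AdjGraph n)

open Classical in
/-- Classical topological sort of the non-sinks. `placed` holds the vertices placed so far, and
`cnt v` is the number of in-neighbours of `v` that are not placed yet. In a round, the vertices are
scanned for a non-sink that is not placed and has counter `0`; it is placed, and the counters of
its out-neighbours decrease. A round takes one step per scanned vertex and per changed counter. -/
def topSortLoop : ℕ → List (Fin n) → (Fin n → ℕ) → Timed (List (Fin n))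
  | 0, placed, _ => pure placed
  | r + 1, placed, cnt =>
    match (List.finRange n).find? (fun v => G.out v ≠ [] ∧ v ∉ placed ∧ cnt v = 0) with
    | none => do
      Timed.tick n
      pure placed
    | some v => do
      Timed.tick (n + (G.out v).length)
      topSortLoop r (placed ++ [v]) (fun u => if u ∈ G.out v then cnt u - 1 else cnt u)

/-- The list of all vertices in topological order, with the sinks at the end. -/
def topSort : Timed (List (Fin n)) := do
  Timed.tick n
  let placed ← topSortLoop G G.numNonSinks [] (fun v => (G.inList v).length)
  Timed.tick n
  pure (placed ++ (List.finRange n).filter fun v => G.out v = [])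

open Classical in
/-- An order of the vertices in which the graph is ordered. The topological sort is invoked only if
the given numbering is not yet ordered, which is tested by one pass over the lists. -/
def vertexOrder : Timed (List (Fin n)) := do
  Timed.tick (n + G.numEdges)
  if G.Ordered then pure (List.finRange n) else topSort G

/-- The number of runs in the boosted minimum search. -/
def boostCount (n : ℕ) : ℕ := ⌈2 * Real.logb 2 n⌉₊

open Classical in
/-- Processing the vertex `i` in the run from one source. The state consists of the array `t` of
path lengths and of the maximum found so far. The entry `t i` becomes one plus the (boosted
quantum) minimum of `t` over the in-neighbours of `i`, and the maximum is updated if `t i` is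
finite, that is, if a path to `i` was found, and larger. -/
def processVertex (s : (Fin n → ℕ∞) × WithBot ℕ) (i : Fin n) :
    Timed ((Fin n → ℕ∞) × WithBot ℕ) := do
  let v ← boostedMin (boostCount n) ((G.inList i).map s.1)
  Timed.tick 1
  let d : ℕ∞ := v + 1
  pure (Function.update s.1 i d, if d = ⊤ then s.2 else max s.2 (d.toNat : WithBot ℕ))

/-- The run from the source `z`, where `later` lists the vertices after `z`: the array is
initialized with `0` at `z` and `+∞` elsewhere, and the later vertices are processed in order. -/
def processSource (z : Fin n) (later : List (Fin n)) (maxLen : WithBot ℕ) :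
    Timed (WithBot ℕ) := do
  Timed.tick n
  let s ← later.foldlM (processVertex G) (Function.update (fun _ => ⊤) z 0, maxLen)
  pure s.2

/-- The quantum algorithm for the diameter search. The lists of in-neighbours are set up by one
pass over the input, the vertices are put in order, and then the positions of the non-sinks are
taken in decreasing order as the source. The result `-∞` (no non-sink) stands for diameter `0`. -/
def diameterAlg : Timed ℕ := do
  Timed.tick (n + G.numEdges)
  let order ← vertexOrder G
  let maxLen ← (List.range G.numNonSinks).reverse.foldlM
    (fun (M : WithBot ℕ) (p : ℕ) =>
      match order.drop p with
      | [] => pure M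
      | z :: later => processSource G z later M)
    ⊥
  Timed.tick 1
  pure (maxLen.unbotD 0)

end Algorithm

end DagDiameter

end

noncomputable section

namespace DagDiameter

/-! ### Probability and running time of composed randomized computations -/

namespace Timed

variable {α β : Type}

/-! The correctness of a run without failures is separated from the probability that some minimum
search fails. If no search fails, processing the vertices in topological order computes exact
distances from each source, since a shortest path to `j` is a shortest path to some in-neighbour
plus one edge (`dist_eq_sInf_add_one`). Sinks are not needed as sources, because only the empty path
leaves them (`foldl_idealRun_eq_diam`). There are at most `n²` boosted searches, so it is enough
that each fails with probability at most `n⁻³`, whatever the state in which it is started; a union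
bound along the folds gives `1/n`.

With about `2 log₂ n` runs, failure probability `1/2` for a single search would only give `n⁻²`. A
bound below `2^(-3/2) = 0.35355…` is needed, and `failBound` is `0.3535`. It comes from Markov's
inequality: the expected time until the threshold is the minimum is at most `0.3535` times the
cutoff. This estimate has three layers. Grover iterations rotate in a plane, so the success
probability of a round is explicit (`groverState_apply`, `searchProb_eq`). A potential that
dominates the mean cost of a round plus the mean potential after it (`searchPotential_step`) bounds
a search for one of `t` marked items by `13/4 √(N/t) + 6/5`. Finally, a successful measurement is
uniform on the marked items, so the item of rank `r` ever becomes the threshold with probability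
`1/(r+1)` when there are no ties, and ties only help. Summation gives about `13/2 √N + ln 2 · log₂²
N`, which `start_cost_le` compares with the cutoff.

The time bound holds on every run, not only on average: the interruption limits a search among `N`
items to `O(√N)` steps, and by Cauchy–Schwarz the square roots of the in-degrees add up to at most
`√(nm)`. -/

theorem law_bind (p : Timed α) (f : α → Timed β) :
    (p >>= f).law = p.law.bind fun a => (f a.1).law.map fun b => (b.1, a.2 + b.2) := rfl

theorem law_pure (a : α) : (pure a : Timed α).law = PMF.pure (a, 0) := rfl

theorem law_tick (k : ℕ) : (tick k).law = PMF.pure ((), k) := rfl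

theorem law_sample (p : PMF α) : (sample p).law = p.map fun a => (a, 0) := rfl

theorem prob_bind (p : Timed α) (f : α → Timed β) (P : β → Prop) :
    (p >>= f).prob P = ∑' a, p.law a * (f a.1).prob P := by
  rw [prob, law_bind, PMF.toOuterMeasure_bind_apply]
  refine tsum_congr fun a => ?_
  rw [PMF.toOuterMeasure_map_apply]
  rfl

theorem prob_pure_of_not {a : α} {P : α → Prop} (h : ¬ P a) : (pure a : Timed α).prob P = 0 := by
  rw [prob, law_pure, PMF.toOuterMeasure_pure_apply, if_neg]
  exact h

theorem prob_le_one (p : Timed α) (P : α → Prop) : p.prob P ≤ 1 := by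
  rw [prob, PMF.toOuterMeasure_apply]
  exact (ENNReal.tsum_le_tsum fun a => Set.indicator_le_self _ _ a).trans_eq p.law.tsum_coe

/-- The implication is required only on the support; this is where sure facts enter, such as a
search result never lying below the minimum. -/
theorem prob_mono (p : Timed α) {P Q : α → Prop} (h : ∀ a ∈ p.law.support, P a.1 → Q a.1) :
    p.prob P ≤ p.prob Q := by
  refine PMF.toOuterMeasure_mono _ ?_
  rintro a ⟨ha, hs⟩
  exact h a hs ha

theorem pure_bind_law (a : α) (k : ℕ) (p : Timed α) (hp : p.law = PMF.pure (a, k))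
    (f : α → Timed β) : (p >>= f).law = (f a).law.map fun b => (b.1, k + b.2) := by
  rw [law_bind, hp, PMF.pure_bind]

theorem prob_bind_of_law_pure {a : α} {k : ℕ} {p : Timed α} (hp : p.law = PMF.pure (a, k))
    (f : α → Timed β) (P : β → Prop) : (p >>= f).prob P = (f a).prob P := by
  rw [prob, pure_bind_law a k p hp, PMF.toOuterMeasure_map_apply]
  rfl

theorem prob_tick_bind (k : ℕ) (f : Unit → Timed β) (P : β → Prop) :
    (tick k >>= f).prob P = (f ()).prob P :=
  prob_bind_of_law_pure (law_tick k) f P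

theorem prob_sample_bind (p : PMF α) (f : α → Timed β) (P : β → Prop) :
    (sample p >>= f).prob P = ∑' a, p a * (f a).prob P := by
  rw [prob, law_bind, law_sample, PMF.bind_map, PMF.toOuterMeasure_bind_apply]
  refine tsum_congr fun a => ?_
  simp only [Function.comp]
  rw [PMF.toOuterMeasure_map_apply]
  rfl

theorem prob_bind_pure (p : Timed α) (f : α → β) (P : β → Prop) :
    (p >>= fun a => pure (f a)).prob P = p.prob fun a => P (f a) := by
  classical
  rw [prob_bind, prob, PMF.toOuterMeasure_apply]
  refine tsum_congr fun a => ?_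
  rw [prob, law_pure, PMF.toOuterMeasure_pure_apply]
  by_cases h : P (f a.1) <;> simp [Set.indicator, h]

/-- If the first computation misses `Q` with probability at most `ε`, and the second one started
from `Q` hits `P` with probability at most `δ`, then `P` occurs with probability at most `ε + δ`. -/
theorem prob_bind_le {p : Timed α} {f : α → Timed β} {P : β → Prop} {Q : α → Prop} {ε δ : ℝ≥0∞}
    (hp : (p.prob fun a => ¬ Q a) ≤ ε) (hf : ∀ a, Q a → (f a).prob P ≤ δ) :
    (p >>= f).prob P ≤ ε + δ := by
  classical
  rw [prob_bind]
  calc ∑' a, p.law a * (f a.1).prob P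
      ≤ ∑' a, (Set.indicator {a : α × ℕ | ¬ Q a.1} p.law a + p.law a * δ) := by
        refine ENNReal.tsum_le_tsum fun a => ?_
        by_cases h : Q a.1
        · exact (mul_le_mul_right (hf _ h) _).trans le_add_self
        · refine le_trans ?_ le_self_add
          rw [Set.indicator_of_mem (by exact h)]
          exact (mul_le_mul_right (prob_le_one _ _) _).trans_eq (mul_one _)
    _ ≤ ε + δ := by
        rw [ENNReal.tsum_add, ENNReal.tsum_mul_right, PMF.tsum_coe, one_mul]
        refine add_le_add ?_ le_rfl
        rwa [prob, PMF.toOuterMeasure_apply] at hp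

/-- The product rule for a computation that must fail twice. -/
theorem prob_bind_le_mul {p : Timed α} {f : α → Timed β} {P : β → Prop} {Q : α → Prop}
    {ε δ : ℝ≥0∞} (hp : p.prob Q ≤ ε) (hf : ∀ a ∈ p.law.support, Q a.1 → (f a.1).prob P ≤ δ)
    (hn : ∀ a ∈ p.law.support, ¬ Q a.1 → (f a.1).prob P = 0) :
    (p >>= f).prob P ≤ ε * δ := by
  classical
  rw [prob_bind]
  calc ∑' a, p.law a * (f a.1).prob P
      ≤ ∑' a, Set.indicator {a : α × ℕ | Q a.1} p.law a * δ := by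
        refine ENNReal.tsum_le_tsum fun a => ?_
        by_cases ha : a ∈ p.law.support
        · by_cases h : Q a.1
          · rw [Set.indicator_of_mem (by exact h)]
            exact mul_le_mul_right (hf _ ha h) _
          · rw [hn a ha h, mul_zero]
            exact zero_le
        · rw [(PMF.apply_eq_zero_iff _ _).2 ha, zero_mul]
          exact zero_le
    _ ≤ ε * δ := by
        rw [ENNReal.tsum_mul_right]
        refine mul_le_mul_left ?_ _
        rwa [prob, PMF.toOuterMeasure_apply] at hp

theorem mem_support_bind {p : Timed α} {f : α → Timed β} {b : β × ℕ} :
    b ∈ (p >>= f).law.support ↔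
      ∃ a ∈ p.law.support, ∃ c ∈ (f a.1).law.support, b = (c.1, a.2 + c.2) := by
  rw [law_bind, PMF.mem_support_bind_iff]
  simp only [PMF.mem_support_map_iff]
  exact ⟨fun ⟨a, ha, c, hc, h⟩ => ⟨a, ha, c, hc, h.symm⟩,
    fun ⟨a, ha, c, hc, h⟩ => ⟨a, ha, c, hc, h.symm⟩⟩

/-- The running time is at most `T` on every run. -/
def TimeLE (p : Timed α) (T : ℝ) : Prop := ∀ a ∈ p.law.support, (a.2 : ℝ) ≤ T

theorem TimeLE.mono {p : Timed α} {S T : ℝ} (h : p.TimeLE S) (hST : S ≤ T) : p.TimeLE T :=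
  fun a ha => (h a ha).trans hST

theorem TimeLE.bind {p : Timed α} {f : α → Timed β} {S T : ℝ} (hp : p.TimeLE S)
    (hf : ∀ a ∈ p.law.support, (f a.1).TimeLE T) : (p >>= f).TimeLE (S + T) := by
  intro b hb
  obtain ⟨a, ha, c, hc, rfl⟩ := mem_support_bind.1 hb
  push_cast
  exact add_le_add (hp a ha) (hf a ha c hc)

theorem timeLE_of_law_pure {p : Timed α} {a : α} {k : ℕ} (hp : p.law = PMF.pure (a, k)) :
    p.TimeLE k := by
  intro b hb
  rw [hp, PMF.support_pure, Set.mem_singleton_iff] at hb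
  simp [hb]

theorem timeLE_pure (a : α) : (pure a : Timed α).TimeLE 0 := by
  simpa using timeLE_of_law_pure (law_pure a)

theorem timeLE_tick (k : ℕ) : (tick k).TimeLE k := timeLE_of_law_pure (law_tick k)

theorem timeLE_sample_bind {p : PMF α} {f : α → Timed β} {T : ℝ}
    (hf : ∀ a ∈ p.support, (f a).TimeLE T) : (sample p >>= f).TimeLE T := by
  have h0 : (sample p).TimeLE 0 := by
    intro a ha
    rw [law_sample, PMF.mem_support_map_iff] at ha
    obtain ⟨a, -, rfl⟩ := ha
    simp
  have := TimeLE.bind (f := f) (T := T) h0 fun a ha => by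
    rw [law_sample, PMF.mem_support_map_iff] at ha
    obtain ⟨a, ha, rfl⟩ := ha
    exact hf a ha
  simpa using this

theorem timeLE_tick_bind {k : ℕ} {f : Unit → Timed β} {T : ℝ} (hf : (f ()).TimeLE T) :
    (tick k >>= f).TimeLE (k + T) :=
  (timeLE_tick k).bind fun _ _ => hf

theorem expectedTime_le {p : Timed α} {T : ℝ} (h : p.TimeLE T) :
    p.expectedTime ≤ ENNReal.ofReal T := by
  rw [expectedTime]
  calc ∑' a : α × ℕ, p.law a * (a.2 : ℝ≥0∞) ≤ ∑' a : α × ℕ, p.law a * ENNReal.ofReal T := by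
        refine ENNReal.tsum_le_tsum fun a => ?_
        by_cases ha : a ∈ p.law.support
        · refine mul_le_mul_right ?_ _
          rw [← ENNReal.ofReal_natCast]
          exact ENNReal.ofReal_le_ofReal (h a ha)
        · rw [(PMF.apply_eq_zero_iff _ _).2 ha, zero_mul]
          exact zero_le
    _ = ENNReal.ofReal T := by rw [ENNReal.tsum_mul_right, PMF.tsum_coe, one_mul]

/-- A fold whose single steps follow the function `g` up to probability `ε` follows the fold of
`g` up to `ε` times the number of steps. -/
theorem prob_foldlM_ne_le {σ ι : Type} {f : σ → ι → Timed σ} {g : σ → ι → σ} {ε : ℝ≥0∞}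
    (l : List ι) (h : ∀ s, ∀ i ∈ l, ((f s i).prob fun s' => ¬ s' = g s i) ≤ ε) (s : σ) :
    ((l.foldlM f s).prob fun s' => ¬ s' = l.foldl g s) ≤ l.length * ε := by
  induction l generalizing s with
  | nil =>
    rw [List.foldlM_nil, prob_pure_of_not (by simp)]
    exact zero_le
  | cons i l ih =>
    rw [List.foldlM_cons, List.foldl_cons]
    refine (prob_bind_le (δ := l.length * ε) (Q := fun t => t = g s i) (h s i (by simp)) ?_).trans_eq ?_
    · rintro _ rfl
      exact ih (fun s j hj => h s j (by simp [hj])) _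
    · rw [List.length_cons, Nat.cast_add, Nat.cast_one, add_mul, one_mul, add_comm]

theorem timeLE_foldlM {σ ι : Type} {f : σ → ι → Timed σ} {T : ι → ℝ} (l : List ι)
    (h : ∀ s, ∀ i ∈ l, (f s i).TimeLE (T i)) (s : σ) :
    (l.foldlM f s).TimeLE (l.map T).sum := by
  induction l generalizing s with
  | nil => exact timeLE_pure _
  | cons i l ih =>
    rw [List.foldlM_cons, List.map_cons, List.sum_cons]
    exact (h s i (by simp)).bind fun a _ => ih (fun s j hj => h s j (by simp [hj])) _

end Timed

/-! ### The Grover iteration as a plane rotation -/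

theorem inner_uniformState {N : ℕ} (ψ : Register N) :
    inner ℂ (uniformState N) ψ = (∑ i, ψ i) * (1 / (Real.sqrt N : ℂ)) := by
  simp only [PiLp.inner_apply, uniformState, RCLike.inner_apply, Finset.sum_mul]
  refine Finset.sum_congr rfl fun i _ => ?_
  congr 1
  rw [← Complex.ofReal_one, ← Complex.ofReal_div, Complex.conj_ofReal]

theorem diffusion_apply {N : ℕ} [NeZero N] (ψ : Register N) (i : Fin N) :
    diffusion N ψ i = 2 / N * (∑ k, ψ k) - ψ i := by
  have hN : (0 : ℝ) < N := Nat.cast_pos.2 (Nat.pos_of_neZero N)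
  have hs : (Real.sqrt N : ℂ) * (Real.sqrt N : ℂ) = N := by
    rw [← Complex.ofReal_mul, Real.mul_self_sqrt hN.le, Complex.ofReal_natCast]
  have hs0 : (Real.sqrt N : ℂ) ≠ 0 := by
    rw [Complex.ofReal_ne_zero]
    exact (Real.sqrt_pos.2 hN).ne'
  rw [diffusion, Submodule.reflection_singleton_apply, inner_uniformState, norm_uniformState]
  simp only [uniformState, PiLp.sub_apply, PiLp.smul_apply, smul_eq_mul, nsmul_eq_mul]
  rw [← hs]
  push_cast
  field_simp

open Classical in
theorem groverStep_apply {N : ℕ} [NeZero N] (marked : Fin N → Prop) (ψ : Register N) (i : Fin N) :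
    groverStep marked ψ i =
      2 / N * (∑ k, if marked k then -ψ k else ψ k) - (if marked i then -ψ i else ψ i) := by
  have h : ∀ k, phaseOracle marked ψ k = if marked k then -ψ k else ψ k := by
    intro k
    simp only [phaseOracle, LinearIsometryEquiv.piLpCongrRight_apply]
    split_ifs <;> simp
  rw [groverStep, LinearIsometryEquiv.trans_apply, diffusion_apply, h]
  simp only [h]

/-- The rotation angle of the Grover iteration with `t` marked items out of `N`. -/
def groverAngle (N t : ℕ) : ℝ := Real.arcsin (Real.sqrt (t / N))

section angle

variable {N t : ℕ}

theorem sin_groverAngle (htN : t < N) : Real.sin (groverAngle N t) = Real.sqrt (t / N) := by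
  have hN : (0 : ℝ) < N := Nat.cast_pos.2 (by omega)
  refine Real.sin_arcsin ?_ ?_
  · linarith [Real.sqrt_nonneg ((t : ℝ) / N)]
  · rw [Real.sqrt_le_iff, one_pow, div_le_one hN]
    exact ⟨zero_le_one, by exact_mod_cast htN.le⟩

theorem cos_groverAngle (htN : t < N) :
    Real.cos (groverAngle N t) = Real.sqrt ((N - t) / N) := by
  have hN : (0 : ℝ) < N := Nat.cast_pos.2 (by omega)
  rw [groverAngle, Real.cos_arcsin, Real.sq_sqrt (by positivity), sub_div, div_self hN.ne']

theorem groverAngle_pos (ht : 0 < t) (htN : t < N) : 0 < groverAngle N t := by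
  have hN : (0 : ℝ) < N := Nat.cast_pos.2 (by omega)
  have ht : (0 : ℝ) < t := Nat.cast_pos.2 (by omega)
  exact Real.arcsin_pos.2 (Real.sqrt_pos.2 (by positivity))

theorem groverAngle_lt (htN : t < N) : groverAngle N t < Real.pi / 2 := by
  have hN : (0 : ℝ) < N := Nat.cast_pos.2 (by omega)
  rw [groverAngle, Real.arcsin_lt_pi_div_two, Real.sqrt_lt' one_pos, one_pow, div_lt_one hN]
  exact_mod_cast htN

theorem sin_two_groverAngle (htN : t < N) :
    Real.sin (2 * groverAngle N t) = 2 * Real.sqrt (t * (N - t)) / N := by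
  have hN : (0 : ℝ) < N := Nat.cast_pos.2 (by omega)
  rw [Real.sin_two_mul, sin_groverAngle htN, cos_groverAngle htN, mul_assoc,
    ← Real.sqrt_mul (by positivity), div_mul_div_comm, Real.sqrt_div' _ (by positivity),
    Real.sqrt_mul_self hN.le, mul_div_assoc]

end angle

open Classical in
/-- The Grover iteration is a rotation in the plane spanned by the marked and by the unmarked
uniform superpositions. -/
theorem groverState_apply {N : ℕ} [NeZero N] (marked : Fin N → Prop) {t : ℕ}
    (hcard : (Finset.univ.filter marked).card = t) (ht : 0 < t) (htN : t < N) (j : ℕ) (i : Fin N) :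
    groverState marked j i =
      (((if marked i then Real.sin ((2 * j + 1) * groverAngle N t) / Real.sqrt t
        else Real.cos ((2 * j + 1) * groverAngle N t) / Real.sqrt (N - t)) : ℝ) : ℂ) := by
  have hN : (0 : ℝ) < N := Nat.cast_pos.2 (by omega)
  have ht0 : (0 : ℝ) < t := Nat.cast_pos.2 ht
  have hu0 : (0 : ℝ) < N - t := by
    rw [sub_pos]
    exact_mod_cast htN
  have hc' : (Finset.univ.filter fun k => ¬ marked k).card = N - t := by
    have := Finset.card_filter_add_card_filter_not (s := (Finset.univ : Finset (Fin N))) marked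
    rw [hcard, Finset.card_univ, Fintype.card_fin] at this
    omega
  set θ := groverAngle N t with hθ
  have hsin : Real.sin θ = Real.sqrt t / Real.sqrt N := by
    rw [hθ, sin_groverAngle htN, Real.sqrt_div ht0.le]
  have hcos : Real.cos θ = Real.sqrt (N - t) / Real.sqrt N := by
    rw [hθ, cos_groverAngle htN, Real.sqrt_div hu0.le]
  have hsN : Real.sqrt N ≠ 0 := (Real.sqrt_pos.2 hN).ne'
  have hst : Real.sqrt t ≠ 0 := (Real.sqrt_pos.2 ht0).ne'
  have hsu : Real.sqrt (N - t : ℝ) ≠ 0 := (Real.sqrt_pos.2 hu0).ne'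
  have hqN : Real.sqrt N ^ 2 = N := Real.sq_sqrt hN.le
  have hqt : Real.sqrt t ^ 2 = t := Real.sq_sqrt ht0.le
  have hqu : Real.sqrt (N - t : ℝ) ^ 2 = N - t := Real.sq_sqrt hu0.le
  induction j generalizing i with
  | zero =>
    simp only [groverState, Function.iterate_zero, id, uniformState, Nat.cast_zero, mul_zero,
      zero_add, one_mul, hsin, hcos]
    split_ifs
    · rw [div_div_cancel_left' hst]
      push_cast
      ring
    · rw [div_div_cancel_left' hsu]
      push_cast
      ring
  | succ j ih =>
    have hstep : groverState marked (j + 1) = groverStep marked (groverState marked j) := by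
      rw [groverState, Function.iterate_succ_apply']
      rfl
    set α := (2 * (j : ℝ) + 1) * θ with hα
    have hα' : (2 * ((j + 1 : ℕ) : ℝ) + 1) * θ = α + 2 * θ := by
      rw [hα]
      push_cast
      ring
    -- Diffusion couples an amplitude to the others only through this signed sum, so one iteration
    -- acts linearly on the pair `(sin α, cos α)`.
    have hsum : (∑ k, if marked k then -groverState marked j k else groverState marked j k) =
        ((-(Real.sqrt t * Real.sin α) + Real.sqrt (N - t) * Real.cos α : ℝ) : ℂ) := by
      have h1 : ∀ k, (if marked k then -groverState marked j k else groverState marked j k) =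
          ((if marked k then -(Real.sin α / Real.sqrt t)
            else Real.cos α / Real.sqrt (N - t) : ℝ) : ℂ) := by
        intro k
        rw [ih]
        split_ifs <;> push_cast <;> rfl
      rw [Finset.sum_congr rfl fun k _ => h1 k, ← Complex.ofReal_sum, Finset.sum_ite,
        Finset.sum_const, Finset.sum_const, hcard, hc']
      congr 1
      rw [nsmul_eq_mul, nsmul_eq_mul, Nat.cast_sub htN.le]
      congr 1
      · rw [mul_neg, neg_inj]
        nth_rw 1 [← hqt]
        field_simp
      · nth_rw 1 [← hqu]
        field_simp
    have hs2 : Real.sin (2 * θ) = 2 * (Real.sqrt t * Real.sqrt (N - t)) / N := by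
      rw [Real.sin_two_mul, hsin, hcos]
      field_simp
      exact hqN.symm
    have hc2 : Real.cos (2 * θ) = 1 - 2 * t / N := by
      rw [Real.cos_two_mul, hcos, div_pow, hqu, hqN]
      field_simp
      ring
    rw [hstep, groverStep_apply, hsum, ih, hα', Real.sin_add, Real.cos_add, hs2, hc2]
    have hNc : (N : ℂ) = ((N : ℝ) : ℂ) := by simp
    split_ifs
    · rw [hNc, ← Complex.ofReal_neg, ← Complex.ofReal_ofNat, ← Complex.ofReal_div,
        ← Complex.ofReal_mul, ← Complex.ofReal_sub]
      congr 1
      field_simp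
      linear_combination (-2 * Real.sin α) * hqt
    · rw [hNc, ← Complex.ofReal_ofNat, ← Complex.ofReal_div,
        ← Complex.ofReal_mul, ← Complex.ofReal_sub]
      congr 1
      field_simp
      linear_combination (2 * Real.cos α) * hqu

/-! ### Success probability of one round of the exponential search -/

/-- The success probability of the exponential search with `M` possible iteration counts. -/
def searchProb (N t M : ℕ) : ℝ :=
  (∑ j ∈ Finset.range M, Real.sin ((2 * j + 1) * groverAngle N t) ^ 2) / M

/-- Telescoping: write each square through the cosine of the double angle and use `2 sin 2θ
cos(2(2j+1)θ) = sin(4(j+1)θ) - sin(4jθ)`. -/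
theorem two_sin_two_mul_sum (M : ℕ) (θ : ℝ) :
    4 * Real.sin (2 * θ) * ∑ j ∈ Finset.range M, Real.sin ((2 * j + 1) * θ) ^ 2 =
      2 * M * Real.sin (2 * θ) - Real.sin (4 * M * θ) := by
  induction M with
  | zero => simp
  | succ M ih =>
    rw [Finset.sum_range_succ, mul_add, ih]
    have h1 : Real.sin (4 * (M + 1 : ℕ) * θ) = Real.sin (4 * M * θ) +
        2 * Real.sin (2 * θ) * Real.cos (2 * ((2 * M + 1) * θ)) := by
      have e1 : 4 * ((M + 1 : ℕ) : ℝ) * θ = 2 * ((2 * M + 1) * θ) + 2 * θ := by push_cast; ring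
      have e2 : 4 * (M : ℝ) * θ = 2 * ((2 * M + 1) * θ) - 2 * θ := by ring
      rw [e1, e2, Real.sin_add, Real.sin_sub]
      ring
    rw [h1, Real.cos_two_mul, Real.cos_sq']
    push_cast
    ring

section searchProb

variable {N t M : ℕ}

theorem searchProb_eq (ht : 0 < t) (htN : t < N) (hM : 0 < M) :
    searchProb N t M = 1 / 2 - Real.sin (4 * M * groverAngle N t) /
      (4 * M * Real.sin (2 * groverAngle N t)) := by
  have hM' : (0 : ℝ) < M := Nat.cast_pos.2 hM
  have hs : 0 < Real.sin (2 * groverAngle N t) :=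
    Real.sin_pos_of_pos_of_lt_pi (by linarith [groverAngle_pos ht htN])
      (by linarith [groverAngle_lt htN])
  have h := two_sin_two_mul_sum M (groverAngle N t)
  rw [searchProb]
  generalize Real.sin (4 * M * groverAngle N t) = c at *
  generalize ∑ j ∈ Finset.range M, Real.sin ((2 * j + 1) * groverAngle N t) ^ 2 = S at *
  field_simp
  linarith

theorem searchProb_one (htN : t < N) : searchProb N t 1 = t / N := by
  simp only [searchProb, Finset.range_one, Finset.sum_singleton, Nat.cast_zero, mul_zero,
    zero_add, one_mul, Nat.cast_one, div_one]
  rw [sin_groverAngle htN, Real.sq_sqrt (by positivity)]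

theorem searchProb_le_one (hM : 0 < M) : searchProb N t M ≤ 1 := by
  have hM' : (0 : ℝ) < M := Nat.cast_pos.2 hM
  rw [searchProb, div_le_one hM']
  refine (Finset.sum_le_card_nsmul _ _ 1 fun j _ => Real.sin_sq_le_one _).trans ?_
  simp

/-- The inverse of `sin 2θ`, where `θ` is the angle of the Grover iteration. -/
def searchScale (N t : ℕ) : ℝ := N / (2 * Real.sqrt (t * (N - t)))

/-- Bound the oscillating sine by `1`. The real parameter `m` replaces its ceiling `M`, so that the
potentials below need no rounding. -/
theorem searchProb_ge (ht : 0 < t) (htN : t < N) {m : ℝ} (hm : 0 < m) (hmM : m ≤ M) :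
    1 / 2 - searchScale N t / (4 * m) ≤ searchProb N t M := by
  have hM' : (0 : ℝ) < M := hm.trans_le hmM
  have hN : (0 : ℝ) < N := Nat.cast_pos.2 (by omega)
  have ht0 : (0 : ℝ) < t := Nat.cast_pos.2 ht
  have hu0 : (0 : ℝ) < N - t := by
    rw [sub_pos]
    exact_mod_cast htN
  have hq : 0 < Real.sqrt (t * (N - t) : ℝ) := Real.sqrt_pos.2 (by positivity)
  rw [searchProb_eq ht htN (Nat.cast_pos.1 hM'), sin_two_groverAngle htN, searchScale]
  have h1 : Real.sin (4 * M * groverAngle N t) / (4 * M * (2 * Real.sqrt (t * (N - t)) / N)) ≤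
      1 / (4 * M * (2 * Real.sqrt (t * (N - t)) / N)) := by
    gcongr
    exact Real.sin_le_one _
  have h2 : 1 / (4 * M * (2 * Real.sqrt (t * (N - t)) / N)) ≤
      1 / (4 * m * (2 * Real.sqrt (t * (N - t)) / N)) := by
    gcongr
  have h3 : 1 / (4 * m * (2 * Real.sqrt (t * (N - t)) / N)) =
      N / (2 * Real.sqrt (t * (N - t))) / (4 * m) := by
    field_simp
  linarith

/-- For many marked items `sin 2θ` may be tiny and `searchProb_ge` is useless. Reflect to `φ = π/2 -
θ ≤ π/4`, which reverses the sign of the error term. If `4Mφ ≤ π`, the term helps and the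
probability is at least `1/2`; otherwise Jordan's inequality gives `M sin 2φ ≥ 1`, so the error is
at most `1/4`. -/
theorem searchProb_ge_quarter (htN : t < N) (h : N ≤ 2 * t) (hM : 0 < M) :
    1 / 4 ≤ searchProb N t M := by
  have ht : 0 < t := by omega
  have hM' : (0 : ℝ) < M := Nat.cast_pos.2 hM
  have hN : (0 : ℝ) < N := Nat.cast_pos.2 (by omega)
  set φ := Real.pi / 2 - groverAngle N t with hφ
  have hθ : groverAngle N t = Real.pi / 2 - φ := by rw [hφ]; ring
  have hφ0 : 0 < φ := by
    rw [hφ]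
    linarith [groverAngle_lt htN]
  have hφ1 : φ ≤ Real.pi / 4 := by
    have : Real.pi / 4 ≤ groverAngle N t := by
      rw [groverAngle, Real.le_arcsin_iff_sin_le' (by constructor <;> linarith [Real.pi_pos]),
        Real.sin_pi_div_four]
      refine Real.le_sqrt_of_sq_le ?_
      rw [div_pow, Real.sq_sqrt zero_le_two, le_div_iff₀ hN]
      have : (N : ℝ) ≤ 2 * t := by exact_mod_cast h
      linarith
    linarith
  have hs2 : Real.sin (2 * groverAngle N t) = Real.sin (2 * φ) := by
    rw [hθ, mul_sub, mul_div_cancel₀ _ two_ne_zero, Real.sin_pi_sub]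
  have hs4 : Real.sin (4 * M * groverAngle N t) = -Real.sin (4 * M * φ) := by
    have : 4 * (M : ℝ) * groverAngle N t = -(4 * M * φ) + M * (2 * Real.pi) := by
      rw [hθ]
      ring
    rw [this, Real.sin_add_nat_mul_two_pi, Real.sin_neg]
  have hsp : 0 < Real.sin (2 * φ) :=
    Real.sin_pos_of_pos_of_lt_pi (by linarith) (by linarith [Real.pi_pos])
  rw [searchProb_eq ht htN hM, hs2, hs4, neg_div, sub_neg_eq_add]
  rcases le_or_gt (4 * M * φ) Real.pi with hc | hc
  · have : 0 ≤ Real.sin (4 * M * φ) := Real.sin_nonneg_of_nonneg_of_le_pi (by positivity) hc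
    have : 0 ≤ Real.sin (4 * M * φ) / (4 * M * Real.sin (2 * φ)) := by positivity
    linarith
  · have hj := Real.mul_le_sin (x := 2 * φ) (by linarith) (by linarith)
    have h1 : 1 ≤ M * Real.sin (2 * φ) := by
      calc (1 : ℝ) = Real.pi / Real.pi := (div_self Real.pi_pos.ne').symm
        _ ≤ (4 * M * φ) / Real.pi := by gcongr
        _ = M * (2 / Real.pi * (2 * φ)) := by ring
        _ ≤ _ := by gcongr
    have h2 : -(1 / 4) ≤ Real.sin (4 * M * φ) / (4 * M * Real.sin (2 * φ)) := by
      rw [le_div_iff₀ (by positivity)]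
      nlinarith [Real.neg_one_le_sin (4 * M * φ)]
    linarith

end searchProb

/-! ### The expected cost of one exponential search -/

/-- Bound for the expected cost of the remaining search when the parameter `m` has passed the
critical value. -/
def latePotential (D m : ℝ) : ℝ :=
  5 / 4 * m + 3 / 4 * D + 3 / 4 * (D ^ 2 / m) + 2 + 2 * (D / m)

/-- Bound for the expected cost of the remaining search while the parameter `m` is small. -/
def earlyPotential (D m : ℝ) : ℝ :=
  73 / 16 * D - 5 / 2 * m + 63 / 20 + 11 / 2 * Real.log (D / m)

theorem latePotential_mul {y m : ℝ} (hm : 0 < m) : latePotential (y * m) m =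
    m * (5 / 4 + 3 / 4 * y + 3 / 4 * y ^ 2) + 2 + 2 * y := by
  rw [latePotential]
  field_simp

theorem latePotential_mul_step {y m : ℝ} (hm : 0 < m) : latePotential (y * m) (6 / 5 * m) =
    m * (3 / 2 + 3 / 4 * y + 5 / 8 * y ^ 2) + 2 + 5 / 3 * y := by
  rw [latePotential]
  field_simp
  ring

/-- The estimate `log (1 + x) ≥ 2x / (2 + x)` at `x = 1/5` gives `2/11`, whence the coefficient
`11/2` in `earlyPotential`: one growth of `m` by `6/5` pays for the constant cost `1` of a round. -/
theorem eleven_halves_log_ge : 1 ≤ 11 / 2 * Real.log (6 / 5) := by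
  have := Real.le_log_one_add_of_nonneg (x := 1 / 5) (by norm_num)
  norm_num at this ⊢
  linarith

/-- A round costs at most `m/2 + 1` on average and fails with probability at most `1/2 + D/(4m)`. In
powers of `y = D/m`, the coefficients `5/4`, `3/4` and `2` of `m`, `D` and `1` solve the recursion
exactly; those of `D²/m` and `D/m` leave slack that absorbs the next power precisely while `y ≤
8/5`. Hence the critical value `5/8 * D`. -/
theorem late_step {D m : ℝ} (hD : 0 < D) (hm : 0 < m) (h : 5 / 8 * D ≤ m) :
    m / 2 + 1 + (1 / 2 + D / (4 * m)) * latePotential D (6 / 5 * m) ≤ latePotential D m := by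
  obtain ⟨y, rfl⟩ : ∃ y, D = y * m := ⟨D / m, by field_simp⟩
  have hy : 0 < y := pos_of_mul_pos_left hD hm.le
  have hy' : y ≤ 8 / 5 := by
    by_contra hc
    nlinarith
  have e : y * m / (4 * m) = y / 4 := by field_simp
  rw [latePotential_mul hm, latePotential_mul_step hm, e]
  have h1 : 0 ≤ m * (y ^ 2 * (8 / 5 - y)) := by
    have : 0 ≤ 8 / 5 - y := by linarith
    positivity
  have h2 : 0 ≤ y * (8 / 5 - y) := mul_nonneg hy.le (by linarith)
  nlinarith

/-- Covers the rounds in which the bound `√N` stops the growth of `m`; the terms increasing in `m'`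
are estimated at `6/5 * m`, the decreasing ones at `m`. -/
theorem late_cap {D m m' : ℝ} (hD : 0 < D) (h : D ≤ m) (hmm : m ≤ m')
    (hm' : m' ≤ 6 / 5 * m) :
    m / 2 + 1 + (1 / 2 + D / (4 * m)) * latePotential D m' ≤ latePotential D m := by
  have hm : 0 < m := hD.trans_le h
  have h1 : latePotential D m' ≤
      3 / 2 * m + 3 / 4 * D + 3 / 4 * (D ^ 2 / m) + 2 + 2 * (D / m) := by
    rw [latePotential]
    have : D ^ 2 / m' ≤ D ^ 2 / m := by gcongr
    have : D / m' ≤ D / m := by gcongr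
    linarith
  refine (add_le_add_right (mul_le_mul_of_nonneg_left h1 (by positivity)) _).trans ?_
  obtain ⟨y, rfl⟩ : ∃ y, D = y * m := ⟨D / m, by field_simp⟩
  have hy : 0 < y := pos_of_mul_pos_left hD hm.le
  have hy' : y ≤ 1 := by
    by_contra hc
    nlinarith
  have e : y * m / (4 * m) = y / 4 := by field_simp
  have e2 : (y * m) ^ 2 / m = y ^ 2 * m := by field_simp
  have e3 : y * m / m = y := by field_simp
  rw [latePotential_mul hm, e, e2, e3]
  have h1 : 0 ≤ m * (y ^ 2 * (1 - y)) := by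
    have : 0 ≤ 1 - y := by linarith
    positivity
  have h2 : 0 ≤ y * (1 - y) := mul_nonneg hy.le (by linarith)
  nlinarith

/-- Early rounds are treated as certain failures. The costs `m/2` form a geometric series and
telescope against `-5/2 * m`, the constants against the logarithm. -/
theorem early_step {D m : ℝ} (hD : 0 < D) (hm : 0 < m) :
    m / 2 + 1 + earlyPotential D (6 / 5 * m) ≤ earlyPotential D m := by
  have h : Real.log (D / (6 / 5 * m)) = Real.log (D / m) - Real.log (6 / 5) := by
    rw [← Real.log_div (by positivity) (by norm_num)]
    congr 1
    field_simp
  rw [earlyPotential, earlyPotential, h]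
  linarith [eleven_halves_log_ge]

/-- The last early round has `y = D/m` between `8/5` and `48/25`. The coefficient `73/16` makes the
terms linear in `m` agree at `y = 8/5`, and `63/20` leaves enough for the constant terms. -/
theorem early_late {D m : ℝ} (hm : 0 < m) (h : m ≤ 5 / 8 * D) (h' : 5 / 8 * D ≤ 6 / 5 * m) :
    m / 2 + 1 + latePotential D (6 / 5 * m) ≤ earlyPotential D m := by
  obtain ⟨y, rfl⟩ : ∃ y, D = y * m := ⟨D / m, by field_simp⟩
  have hy : 8 / 5 ≤ y := by
    by_contra hc
    nlinarith
  have hy' : y ≤ 48 / 25 := by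
    by_contra hc
    nlinarith
  have e3 : y * m / m = y := by field_simp
  rw [latePotential_mul_step hm, earlyPotential, e3]
  -- Split `log y` at `8/5`: `6/13` is the lower bound `2x/(2+x)` for `log (8/5)`, and the rest is
  -- `log u ≥ 1 - 1/u`.
  have hl : 6 / 13 + (1 - 8 / 5 / y) ≤ Real.log y := by
    have h1 := Real.le_log_one_add_of_nonneg (x := 3 / 5) (by norm_num)
    have h2 := Real.one_sub_inv_le_log_of_pos (x := y / (8 / 5)) (by positivity)
    rw [Real.log_div (by positivity) (by norm_num), inv_div] at h2
    norm_num at h1 h2 ⊢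
    linarith
  have hm1 : 0 ≤ m * ((y - 8 / 5) * (9 / 2 - y)) :=
    mul_nonneg hm.le (mul_nonneg (by linarith) (by linarith))
  have hy2 : 5 / 3 * y ≤ 3 / 20 + 11 / 2 * (6 / 13 + (1 - 8 / 5 / y)) := by
    have : 8 / 5 / y ≤ 1 - (y - 8 / 5) * (25 / 48) := by
      rw [div_le_iff₀ (by linarith)]
      nlinarith
    linarith
  nlinarith

section potential

variable {N t : ℕ}

theorem searchScale_pos (ht : 0 < t) (htN : t < N) : 0 < searchScale N t := by
  have hN : (0 : ℝ) < N := Nat.cast_pos.2 (by omega)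
  have ht0 : (0 : ℝ) < t := Nat.cast_pos.2 ht
  have hu0 : (0 : ℝ) < N - t := by
    rw [sub_pos]
    exact_mod_cast htN
  rw [searchScale]
  positivity

/-- Since `t` and `N - t` are at least `1`, `t(N - t) ≥ N - 1 ≥ N/2`. Consequently the bound `√N` on
the parameter acts only when `m` has already passed the scale `D`. -/
theorem two_mul_searchScale_sq_le (ht : 0 < t) (htN : t < N) : 2 * searchScale N t ^ 2 ≤ N := by
  have hN : (0 : ℝ) < N := Nat.cast_pos.2 (by omega)
  have ht0 : (1 : ℝ) ≤ t := by exact_mod_cast ht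
  have hu0 : (1 : ℝ) ≤ N - t := by
    rw [le_sub_iff_add_le']
    exact_mod_cast htN
  rw [searchScale, div_pow, mul_pow, Real.sq_sqrt (by nlinarith), mul_div_assoc',
    div_le_iff₀ (by nlinarith)]
  nlinarith [mul_nonneg (sub_nonneg.2 ht0) (sub_nonneg.2 hu0)]

/-- Bound for the expected cost of the search for one of `t` marked items among `N` when the
parameter is `m > 1`. -/
def searchPotential (N t : ℕ) (m : ℝ) : ℝ :=
  if 3 * N ≤ 4 * t then 5 * m + 4
  else if m < 5 / 8 * searchScale N t then earlyPotential (searchScale N t) m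
  else latePotential (searchScale N t) m

theorem earlyPotential_nonneg {D m : ℝ} (hm : 0 < m) (h : m ≤ 5 / 8 * D) :
    0 ≤ earlyPotential D m := by
  have hl : 0 ≤ Real.log (D / m) := by
    refine Real.log_nonneg ?_
    rw [le_div_iff₀ hm]
    linarith
  rw [earlyPotential]
  linarith

theorem searchPotential_nonneg (ht : 0 < t) (htN : t < N) {m : ℝ} (hm : 0 < m) :
    0 ≤ searchPotential N t m := by
  have hD := searchScale_pos ht htN
  rw [searchPotential]
  split_ifs with h1 h2
  · positivity
  · exact earlyPotential_nonneg hm h2.le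
  · rw [latePotential]
    positivity

theorem searchPotential_step (ht : 0 < t) (htN : t < N) {m : ℝ} (hm : 1 ≤ m)
    (hmN : m ≤ Real.sqrt N) :
    (⌈m⌉₊ + 1) / 2 + (1 - searchProb N t ⌈m⌉₊) *
      searchPotential N t (min (6 / 5 * m) (Real.sqrt N)) ≤ searchPotential N t m := by
  have hm0 : 0 < m := by linarith
  have hD := searchScale_pos ht htN
  have hM : 0 < ⌈m⌉₊ := Nat.ceil_pos.2 hm0
  have hM1 : ((⌈m⌉₊ : ℕ) : ℝ) ≤ m + 1 := (Nat.ceil_lt_add_one hm0.le).le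
  have hcost : ((⌈m⌉₊ : ℕ) + 1 : ℝ) / 2 ≤ m / 2 + 1 := by linarith
  set m' := min (6 / 5 * m) (Real.sqrt N) with hm'
  have hmm' : m ≤ m' := le_min (by linarith) hmN
  have hm'6 : m' ≤ 6 / 5 * m := min_le_left _ _
  have hP1 := searchProb_le_one (N := N) (t := t) hM
  have hP := searchProb_ge ht htN hm0 (Nat.le_ceil m)
  have hP0 : 0 ≤ searchProb N t ⌈m⌉₊ := by
    rw [searchProb]
    positivity
  have hG' := searchPotential_nonneg ht htN (hm0.trans_le hmm')
  -- With success probability at least `1/4`, the function `5m + 4` solves the recursion exactly: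
  -- `m/2 + 1 + 3/4 (6m + 4) = 5m + 4`.
  by_cases h : 3 * N ≤ 4 * t
  · have hq := searchProb_ge_quarter htN (by omega) hM
    rw [searchPotential, if_pos h] at hG' ⊢
    rw [searchPotential, if_pos h]
    nlinarith
  have hcap : ∀ {m : ℝ}, 0 < m → Real.sqrt N < 6 / 5 * m → searchScale N t ≤ m := by
    intro m hm0 hc
    have h2 := two_mul_searchScale_sq_le ht htN
    rw [Real.sqrt_lt' (by linarith)] at hc
    by_contra hcon
    nlinarith
  set D := searchScale N t with hDdef
  by_cases hl : 5 / 8 * D ≤ m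
  · have e : searchPotential N t m = latePotential D m := by
      rw [searchPotential, if_neg h, if_neg (not_lt.2 hl)]
    have e' : searchPotential N t m' = latePotential D m' := by
      rw [searchPotential, if_neg h, if_neg (not_lt.2 (hl.trans hmm'))]
    rw [e'] at hG' ⊢
    rw [e]
    have key : m / 2 + 1 + (1 / 2 + D / (4 * m)) * latePotential D m' ≤ latePotential D m := by
      rcases le_or_gt (6 / 5 * m) (Real.sqrt N) with hc | hc
      · have : m' = 6 / 5 * m := min_eq_left hc
        rw [this]
        exact late_step hD hm0 hl
      · exact late_cap hD (hcap hm0 hc) hmm' hm'6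
    have : (1 - searchProb N t ⌈m⌉₊) * latePotential D m' ≤
        (1 / 2 + D / (4 * m)) * latePotential D m' :=
      mul_le_mul_of_nonneg_right (by linarith) hG'
    linarith
  · rw [not_le] at hl
    have e : searchPotential N t m = earlyPotential D m := by
      rw [searchPotential, if_neg h, if_pos hl]
    have hc : m' = 6 / 5 * m := by
      refine min_eq_left ?_
      by_contra hc
      have := hcap hm0 (not_le.1 hc)
      linarith
    have : (1 - searchProb N t ⌈m⌉₊) * searchPotential N t m' ≤ searchPotential N t m' :=
      mul_le_of_le_one_left hG' (by linarith)
    have key : m / 2 + 1 + searchPotential N t m' ≤ earlyPotential D m := by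
      rw [hc, searchPotential, if_neg h]
      split_ifs with hs
      · exact early_step hD hm0
      · exact early_late hm0 hl.le (not_lt.1 hs)
    rw [e]
    linarith

/-- Bound for the expected cost of a complete search for one of `t` marked items among `N`. -/
def searchCost (N t : ℕ) : ℝ := 13 / 4 * (Real.sqrt N / Real.sqrt t) + 6 / 5

/-- Here `w = sin θ` and `v = cos θ`, so that `D = 1/sin 2θ`. The hypothesis says that the search is
in the late phase from its second round on, which forces `w ≥ 1/4`. -/
theorem late_start {w v : ℝ} (hw : 0 < w) (hv : 0 < v) (h : w ^ 2 + v ^ 2 = 1)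
    (hD : 5 / 8 * (1 / (2 * w * v)) ≤ 6 / 5) :
    1 + v ^ 2 * latePotential (1 / (2 * w * v)) (6 / 5) ≤ 13 / 4 * (1 / w) + 6 / 5 := by
  have e : v ^ 2 * latePotential (1 / (2 * w * v)) (6 / 5) =
      (7 / 2 * (w * v ^ 2) + 29 / 24 * v + 5 / 32 * (1 / w)) * (1 / w) := by
    rw [latePotential]
    field_simp
    ring
  have hv1 : v ≤ 1 := by nlinarith
  have hw1 : 1 / 4 ≤ w := by
    have : 1 / 4 ≤ w * v := by
      rw [mul_one_div, div_le_iff₀ (by positivity)] at hD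
      linarith
    nlinarith
  have h1 : w * v ^ 2 ≤ 2 / 5 := by
    have : v ^ 2 = 1 - w ^ 2 := by linarith
    rw [this]
    -- `4/7` approximates the maximizer `1/√3` of `w (1 - w²)`.
    nlinarith [sq_nonneg (w - 4 / 7), mul_nonneg hw.le (sq_nonneg (w - 4 / 7))]
  have h2 : 1 / w ≤ 4 := by
    rw [div_le_iff₀ hw]
    linarith
  have h3 : 0 < 1 / w := by positivity
  rw [e]
  have : (7 / 2 * (w * v ^ 2) + 29 / 24 * v + 5 / 32 * (1 / w)) ≤ 13 / 4 := by linarith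
  nlinarith

/-- This case determines the constant `13/4`. Up to an additive constant `D` is at most `1/(2w)`,
and the tangent to `log` at `3` bounds the potential by a line of slope `73/16 + 11/6 < 13/2` in
`D`. -/
theorem early_start {w v : ℝ} (hw : 0 < w) (hv : 1 / 2 ≤ v) (h : w ^ 2 + v ^ 2 = 1)
    (hD : 6 / 5 < 5 / 8 * (1 / (2 * w * v))) :
    1 + earlyPotential (1 / (2 * w * v)) (6 / 5) ≤ 13 / 4 * (1 / w) + 6 / 5 := by
  have hv0 : 0 < v := by linarith
  have hwv : w * v < 25 / 96 := by
    rw [mul_one_div, lt_div_iff₀ (by positivity)] at hD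
    linarith
  -- Bootstrapping: the bound on `w * v` and the identity `w² + v² = 1` improve each other
  -- alternately.
  have hw1 : w < 53 / 100 := by nlinarith
  have hv1 : 84 / 100 < v := by nlinarith
  have hw2 : w < 32 / 100 := by nlinarith
  have hv2 : 94 / 100 < v := by nlinarith
  have hw3 : w < 28 / 100 := by nlinarith
  have hvw : 1 ≤ v * (1 + 4 / 25 * w) := by
    have : 1 ≤ (v * (1 + 4 / 25 * w)) ^ 2 := by
      rw [mul_pow, show v ^ 2 = 1 - w ^ 2 by linarith]
      have : 0 ≤ w * (32 / 100 - 9744 / 10000 * w - 32 / 100 * w ^ 2 - 256 / 10000 * w ^ 3) := by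
        refine mul_nonneg hw.le ?_
        have : w ^ 2 ≤ (28 / 100) ^ 2 := by gcongr
        have : w ^ 3 ≤ (28 / 100) ^ 3 := by gcongr
        linarith
      nlinarith
    exact (one_le_sq_iff₀ (by positivity)).1 this
  set D := 1 / (2 * w * v) with hDd
  have hDpos : 0 < D := by positivity
  have hDV : D ≤ 1 / (2 * w) + 2 / 25 := by
    rw [hDd, div_add_div _ _ (by positivity) (by norm_num), div_le_div_iff₀ (by positivity)
      (by positivity)]
    nlinarith
  have hlog : Real.log (D / (6 / 5)) = Real.log D - Real.log (6 / 5) :=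
    Real.log_div hDpos.ne' (by norm_num)
  have h3 : Real.log D ≤ D / 3 - 1 + Real.log 3 := by
    have := Real.log_le_sub_one_of_pos (x := D / 3) (by positivity)
    rw [Real.log_div hDpos.ne' (by norm_num)] at this
    linarith
  have hw4 : 1 / w = 2 * (1 / (2 * w)) := by field_simp
  rw [earlyPotential, hlog, hw4]
  have := eleven_halves_log_ge
  have := Real.log_three_lt_d9
  have : 48 / 25 < D := by linarith
  linarith

/-- The first round has `m = 1`: no iteration is applied, it costs `1`, and measuring the uniform
state succeeds with probability `t/N`. Only then does the potential start, at `6/5`. -/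
theorem searchPotential_start (ht : 0 < t) (htN : t < N) :
    1 + (1 - (t : ℝ) / N) * searchPotential N t (6 / 5) ≤ searchCost N t := by
  have hN : (0 : ℝ) < N := Nat.cast_pos.2 (by omega)
  have ht0 : (0 : ℝ) < t := Nat.cast_pos.2 ht
  have hu0 : (0 : ℝ) < N - t := by
    rw [sub_pos]
    exact_mod_cast htN
  set w := Real.sqrt t / Real.sqrt N with hw
  set v := Real.sqrt (N - t) / Real.sqrt N with hv
  have hw0 : 0 < w := by positivity
  have hv0 : 0 < v := by positivity
  have hw2 : w ^ 2 = t / N := by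
    rw [hw, div_pow, Real.sq_sqrt ht0.le, Real.sq_sqrt hN.le]
  have hv2 : v ^ 2 = 1 - t / N := by
    rw [hv, div_pow, Real.sq_sqrt hu0.le, Real.sq_sqrt hN.le, sub_div, div_self hN.ne']
  have hwv : w ^ 2 + v ^ 2 = 1 := by rw [hw2, hv2]; ring
  have hD : searchScale N t = 1 / (2 * w * v) := by
    rw [searchScale, Real.sqrt_mul ht0.le, hw, hv]
    nth_rw 1 [← Real.mul_self_sqrt hN.le]
    have : Real.sqrt (N - t : ℝ) ≠ 0 := (Real.sqrt_pos.2 hu0).ne'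
    have : Real.sqrt (t : ℝ) ≠ 0 := (Real.sqrt_pos.2 ht0).ne'
    have : Real.sqrt (N : ℝ) ≠ 0 := (Real.sqrt_pos.2 hN).ne'
    field_simp
  have hc : searchCost N t = 13 / 4 * (1 / w) + 6 / 5 := by
    rw [searchCost, hw, one_div_div]
  rw [← hv2, hc, searchPotential, hD]
  have hv1 : v ^ 2 ≤ 1 := by nlinarith
  split_ifs with h1 h2
  · have h3 : v ^ 2 ≤ 1 / 4 := by
      rw [hv2]
      have : (3 : ℝ) / 4 ≤ t / N := by
        rw [div_le_div_iff₀ (by norm_num) hN]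
        have : (3 : ℝ) * N ≤ 4 * t := by exact_mod_cast h1
        linarith
      linarith
    have h4 : 1 ≤ 1 / w := by
      rw [le_div_iff₀ hw0]
      nlinarith
    linarith
  · have h3 : 1 / 2 ≤ v := by
      have : 1 / 4 ≤ v ^ 2 := by
        rw [hv2]
        have : (t : ℝ) / N ≤ 3 / 4 := by
          rw [div_le_div_iff₀ hN (by norm_num)]
          have : (4 : ℝ) * t ≤ 3 * N := by exact_mod_cast (not_le.1 h1).le
          linarith
        linarith
      nlinarith
    have := mul_le_of_le_one_left
      (earlyPotential_nonneg (m := 6 / 5) (by norm_num) h2.le) hv1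
    linarith [early_start hw0 h3 hwv h2]
  · exact late_start hw0 hv0 hwv (not_lt.1 h2)

end potential

/-! ### The expected cost of the descent through the thresholds -/

/-- Bound for the expected cost of all searches after the first one, when `s` items lie below the
threshold. The start of a search takes `κ`. -/
def descentCost (κ : ℝ) (N s : ℕ) : ℝ := ∑ r ∈ Finset.Ico 1 s, (κ + searchCost N r) / (r + 1)

/-- Bound for the expected cost of all searches, including their starts. -/
def thresholdCost (κ : ℝ) (N s : ℕ) : ℝ :=
  if s = 0 then 0 else κ + searchCost N s + descentCost κ N s

section descent

variable {κ : ℝ} {N : ℕ}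

theorem searchCost_nonneg (N t : ℕ) : 0 ≤ searchCost N t := by
  rw [searchCost]
  positivity

theorem descentCost_nonneg (hκ : 0 ≤ κ) (s : ℕ) : 0 ≤ descentCost κ N s :=
  Finset.sum_nonneg fun r _ => div_nonneg (add_nonneg hκ (searchCost_nonneg _ _)) (by positivity)

theorem thresholdCost_nonneg (hκ : 0 ≤ κ) (s : ℕ) : 0 ≤ thresholdCost κ N s := by
  rw [thresholdCost]
  split_ifs
  · exact le_rfl
  · exact add_nonneg (add_nonneg hκ (searchCost_nonneg _ _)) (descentCost_nonneg hκ _)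

theorem descentCost_succ {s : ℕ} (hs : 1 ≤ s) : descentCost κ N (s + 1) =
    descentCost κ N s + (κ + searchCost N s) / (s + 1) :=
  Finset.sum_Ico_succ_top hs _

/-- The recursion of the descent: the next threshold is uniform among the `s` items below, of ranks
`0, …, s - 1`. Differencing in `s` solves it, with the weights `1/(r+1)` of `descentCost`. -/
theorem mul_descentCost (s : ℕ) :
    s * descentCost κ N s = ∑ r ∈ Finset.range s, thresholdCost κ N r := by
  induction s with
  | zero => simp
  | succ s ih =>
    rw [Finset.sum_range_succ, ← ih]
    rcases Nat.eq_zero_or_pos s with rfl | hs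
    · simp [descentCost, thresholdCost]
    · rw [descentCost_succ hs, thresholdCost, if_neg hs.ne']
      push_cast
      field_simp
      ring

/-- A single search gets cheaper when more items are marked, but the longer descent outweighs this.
Monotonicity is what allows `sum_card_lt_le` to reduce tables with ties to distinct values. -/
theorem thresholdCost_mono (hκ : 0 ≤ κ) : Monotone (thresholdCost κ N) := by
  refine monotone_nat_of_le_succ fun s => ?_
  rcases Nat.eq_zero_or_pos s with rfl | hs
  · rw [thresholdCost, if_pos rfl]
    exact thresholdCost_nonneg hκ _
  · rw [thresholdCost, if_neg hs.ne', thresholdCost, if_neg (by omega), descentCost_succ hs]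
    have hs0 : (0 : ℝ) < s := Nat.cast_pos.2 hs
    have h1 : Real.sqrt N / Real.sqrt s ≤
        Real.sqrt N / Real.sqrt (s + 1 : ℕ) + Real.sqrt N / Real.sqrt s / (s + 1) := by
      have hq : 0 < Real.sqrt s := Real.sqrt_pos.2 hs0
      have hq1 : 0 < Real.sqrt (s + 1 : ℕ) := Real.sqrt_pos.2 (by positivity)
      have hqq : Real.sqrt s ^ 2 = s := Real.sq_sqrt hs0.le
      have hqq1 : Real.sqrt (s + 1 : ℕ) ^ 2 = (s : ℝ) + 1 := by
        rw [Real.sq_sqrt (by positivity)]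
        push_cast
        rfl
      have hle : Real.sqrt s ≤ Real.sqrt (s + 1 : ℕ) := Real.sqrt_le_sqrt (by push_cast; linarith)
      have e : Real.sqrt N / Real.sqrt (s + 1 : ℕ) + Real.sqrt N / Real.sqrt s / (s + 1) -
          Real.sqrt N / Real.sqrt s = Real.sqrt N * (Real.sqrt (s + 1 : ℕ) - Real.sqrt s) /
            (s + 1) := by
        rw [← hqq1]
        field_simp
        rw [hqq1]
        linear_combination Real.sqrt N * hqq
      have : 0 ≤ Real.sqrt N * (Real.sqrt (s + 1 : ℕ) - Real.sqrt s) / (s + 1) := by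
        have := sub_nonneg.2 hle
        positivity
      linarith
    have h2 : (κ + searchCost N s) / (s + 1) ≥
        13 / 4 * (Real.sqrt N / Real.sqrt s / (s + 1)) := by
      rw [ge_iff_le, mul_div_assoc', searchCost]
      gcongr
      linarith
    rw [searchCost, searchCost] at *
    linarith

/-- A monotone function of the number of smaller items, summed over all items, is largest when
there are no ties. -/
theorem sum_card_lt_le {ι γ : Type*} [LinearOrder γ] (x : ι → γ) {W : ℕ → ℝ} (hW : Monotone W)
    (A : Finset ι) :
    ∑ i ∈ A, W (A.filter fun k => x k < x i).card ≤ ∑ r ∈ Finset.range A.card, W r := by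
  classical
  induction A using Finset.induction_on_max_value x with
  | empty => simp
  | insert a A ha hmax ih =>
    rw [Finset.sum_insert ha, Finset.card_insert_of_notMem ha, Finset.sum_range_succ, add_comm]
    refine add_le_add (le_trans (Finset.sum_le_sum fun i hi => ?_) ih) (hW ?_)
    · rw [Finset.filter_insert, if_neg (not_lt.2 (hmax i hi))]
    · rw [Finset.filter_insert, if_neg (lt_irrefl _)]
      exact Finset.card_filter_le _ _

/-- Telescoping: `1/(r+1)` is at most an increment of the logarithm, and `1/(√r (r+1))` at most
twice a decrement of `1/√r`. -/
theorem descentCost_le (hκ : 0 ≤ κ) {s : ℕ} (hs : 1 ≤ s) : descentCost κ N s ≤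
    (κ + 6 / 5) * Real.log s + 13 / 2 * (Real.sqrt N * (1 - 1 / Real.sqrt s)) := by
  induction s, hs using Nat.le_induction with
  | base => simp [descentCost]
  | succ s hs ih =>
    have hs0 : (0 : ℝ) < s := Nat.cast_pos.2 hs
    rw [descentCost_succ hs]
    have h1 : 1 / ((s : ℝ) + 1) ≤ Real.log (s + 1 : ℕ) - Real.log s := by
      rw [← Real.log_div (by positivity) hs0.ne']
      refine le_trans (le_of_eq ?_) (Real.one_sub_inv_le_log_of_pos (by positivity))
      push_cast
      field_simp
      ring
    have h2 : 1 / Real.sqrt s / (s + 1) ≤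
        2 * (1 / Real.sqrt s - 1 / Real.sqrt (s + 1 : ℕ)) := by
      have hq : 0 < Real.sqrt s := Real.sqrt_pos.2 hs0
      have hq1 : 0 < Real.sqrt (s + 1 : ℕ) := Real.sqrt_pos.2 (by positivity)
      have hqq : Real.sqrt s ^ 2 = s := Real.sq_sqrt hs0.le
      have hqq1 : Real.sqrt (s + 1 : ℕ) ^ 2 = (s : ℝ) + 1 := by
        rw [Real.sq_sqrt (by positivity)]
        push_cast
        rfl
      rw [div_sub_div _ _ hq.ne' hq1.ne', ← hqq1, div_div, mul_div_assoc',
        div_le_div_iff₀ (by positivity) (by positivity)]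
      have hle : Real.sqrt s ≤ Real.sqrt (s + 1 : ℕ) := Real.sqrt_le_sqrt (by push_cast; linarith)
      have h3 : (Real.sqrt (s + 1 : ℕ) - Real.sqrt s) *
          (Real.sqrt (s + 1 : ℕ) + Real.sqrt s) = 1 := by
        linear_combination hqq1 - hqq
      have h4 : 1 ≤ 2 * Real.sqrt (s + 1 : ℕ) * (Real.sqrt (s + 1 : ℕ) - Real.sqrt s) := by
        nlinarith
      calc 1 * (Real.sqrt s * Real.sqrt (s + 1 : ℕ))
          ≤ (2 * Real.sqrt (s + 1 : ℕ) * (Real.sqrt (s + 1 : ℕ) - Real.sqrt s)) *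
            (Real.sqrt s * Real.sqrt (s + 1 : ℕ)) := by gcongr
        _ = _ := by ring
    have e : (κ + searchCost N s) / (s + 1) = (κ + 6 / 5) * (1 / ((s : ℝ) + 1)) +
        13 / 4 * (Real.sqrt N * (1 / Real.sqrt s / (s + 1))) := by
      rw [searchCost]
      field_simp
      ring
    rw [e]
    have h5 := mul_le_mul_of_nonneg_left h1 (show 0 ≤ κ + 6 / 5 by linarith)
    have h6 := mul_le_mul_of_nonneg_left h2 (Real.sqrt_nonneg N)
    linarith

end descent

theorem clog_le_logb_add_one {N : ℕ} (hN : 1 ≤ N) : (Nat.clog 2 N : ℝ) ≤ Real.logb 2 N + 1 := by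
  have := Real.natCeil_logb_natCast 2 N
  rw [← this]
  push_cast
  exact (Nat.ceil_lt_add_one (Real.logb_nonneg one_lt_two (by exact_mod_cast hN))).le

/-- Here `L = log₂ N`, `q = √N` and `c = ln 2 / 6`. The inequality is tight near `L = 6`, so `q = 8
exp((L - 6)c)³` is bounded below by `exp x ≥ 1 + x` around that point, which leaves a polynomial
inequality in `z = L - 6 ≥ -5`. -/
theorem start_cost_numeric {L q c : ℝ} (hL : 1 ≤ L) (hc1 : 0.1155 ≤ c) (hc2 : c ≤ 0.1156)
    (hc : 8 * (1 + (L - 6) * c) ^ 3 ≤ q) : 1 + (L + 1 + 6 / 5) * (L * 0.69315) +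
      13 / 2 * (q - 1) ≤ 7 / 20 * (101 / 100) * (22.5 * q + 1.4 * L ^ 2) := by
  obtain ⟨z, rfl⟩ : ∃ z, L = z + 6 := ⟨L - 6, by ring⟩
  have hz5 : -5 ≤ z := by linarith
  rw [show z + 6 - 6 = z by ring] at hc
  have hc3 : 0.0013 ≤ c ^ 3 := by
    calc (0.0013 : ℝ) ≤ 0.1155 ^ 3 := by norm_num
      _ ≤ c ^ 3 := by gcongr
  have hc4 : c ^ 3 ≤ 0.0016 := by
    calc c ^ 3 ≤ 0.1156 ^ 3 := by gcongr
      _ ≤ 0.0016 := by norm_num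
  have hc5 : 0.0133 ≤ c ^ 2 := by
    calc (0.0133 : ℝ) ≤ 0.1155 ^ 2 := by norm_num
      _ ≤ c ^ 2 := by gcongr
  have h3 : -5 * c ^ 3 * z ^ 2 ≤ c ^ 3 * z * z ^ 2 := by
    have : 0 ≤ c ^ 3 * z ^ 2 * (z + 5) := by
      have : 0 ≤ z + 5 := by linarith
      positivity
    nlinarith
  have h4 : 0.0133 * z ^ 2 ≤ c ^ 2 * z ^ 2 := by gcongr
  have h5 : c ^ 3 * z ^ 2 ≤ 0.0016 * z ^ 2 := by gcongr
  have h6 : 0.1155 * z - 0.0005 ≤ c * z + 0.0001 * z ^ 2 := by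
    nlinarith [sq_nonneg (z + 1), sq_nonneg (z - 1)]
  have e : (1 + z * c) ^ 3 = 1 + 3 * (c * z) + 3 * (c ^ 2 * z ^ 2) + c ^ 3 * z * z ^ 2 := by
    ring
  rw [e] at hc
  nlinarith [sq_nonneg (z + 1)]

/-- The constant in the bound for the failure probability of one minimum search. -/
theorem start_cost_le {N : ℕ} (hN : 2 ≤ N) :
    Nat.clog 2 N / N + descentCost (Nat.clog 2 N) N N ≤ 7 / 20 * (101 / 100) * cutoff N := by
  have hN0 : (0 : ℝ) < N := Nat.cast_pos.2 (by omega)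
  have hκ := clog_le_logb_add_one (N := N) (by omega)
  have hκN : (Nat.clog 2 N : ℝ) / N ≤ 1 := by
    rw [div_le_one hN0]
    exact_mod_cast Nat.clog_le_of_le_pow Nat.lt_two_pow_self.le
  have hU := descentCost_le (N := N) (Nat.cast_nonneg (Nat.clog 2 N)) (show 1 ≤ N by omega)
  set κ := (Nat.clog 2 N : ℝ)
  set L := Real.logb 2 N with hL
  set q := Real.sqrt N with hq
  have hq0 : 0 < q := Real.sqrt_pos.2 hN0
  have hl1 := Real.log_two_gt_d9
  have hl2 := Real.log_two_lt_d9
  have hlog : Real.log N = L * Real.log 2 := by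
    rw [hL, Real.logb, div_mul_cancel₀ _ (by linarith)]
  have hL1 : 1 ≤ L := by
    rw [hL, Real.le_logb_iff_rpow_le one_lt_two hN0, Real.rpow_one]
    exact_mod_cast hN
  have hg : 0 ≤ 1 + (L - 6) * (Real.log 2 / 6) := by nlinarith
  have hqg : 8 * (1 + (L - 6) * (Real.log 2 / 6)) ^ 3 ≤ q := by
    have h1 : q = 8 * Real.exp ((L - 6) * (Real.log 2 / 6)) ^ 3 := by
      rw [← Real.exp_nat_mul, show (8 : ℝ) = Real.exp (3 * Real.log 2) by
        rw [show (3 : ℝ) = (3 : ℕ) by norm_num, Real.exp_nat_mul, Real.exp_log two_pos]; norm_num,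
        ← Real.exp_add, hq, Real.sqrt_eq_rpow, Real.rpow_def_of_pos hN0, hlog]
      congr 1
      push_cast
      ring
    rw [h1]
    gcongr
    linarith [Real.add_one_le_exp ((L - 6) * (Real.log 2 / 6))]
  have hmain : 1 + (L + 1 + 6 / 5) * (L * Real.log 2) + 13 / 2 * (q - 1) ≤
      7 / 20 * (101 / 100) * (22.5 * q + 1.4 * L ^ 2) := by
    have h1 : (L + 1 + 6 / 5) * (L * Real.log 2) ≤ (L + 1 + 6 / 5) * (L * 0.69315) := by
      gcongr
      linarith
    linarith [start_cost_numeric hL1 (by linarith) (by linarith) hqg]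
  have h7 : q * (1 - 1 / q) = q - 1 := by field_simp
  rw [h7, hlog] at hU
  rw [cutoff]
  have h8 : (κ + 6 / 5) * (L * Real.log 2) ≤ (L + 1 + 6 / 5) * (L * Real.log 2) := by
    gcongr
  linarith

/-! ### The failure probability of the minimum search -/

theorem Timed.prob_sample_map_bind {α β γ : Type} (p : PMF γ) (g : γ → α) (f : α → Timed β)
    (P : β → Prop) :
    (Timed.sample (p.map g) >>= f).prob P = ∑' c, p c * (f (g c)).prob P := by
  rw [Timed.prob, Timed.law_bind, Timed.law_sample, PMF.map_comp, PMF.bind_map,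
    PMF.toOuterMeasure_bind_apply]
  refine tsum_congr fun a => ?_
  simp only [Function.comp]
  rw [PMF.toOuterMeasure_map_apply]
  rfl

theorem iterationCount_eq_map (m : ℝ) : iterationCount m =
    PMF.map (fun j : Fin (⌈m⌉₊ - 1 + 1) => (j : ℕ)) (PMF.uniformOfFintype _) :=
  PMF.map_id _

/-- The number of items smaller than the item `y`. -/
def numBelow {N : ℕ} (x : Fin N → ℕ∞) (y : Fin N) : ℕ :=
  (Finset.univ.filter fun i => x i < x y).card

section loop

variable {N : ℕ} (x : Fin N → ℕ∞)

theorem numBelow_lt (y : Fin N) : numBelow x y < N := by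
  have h : (Finset.univ.filter fun i => x i < x y) ⊂ Finset.univ := by
    refine (Finset.filter_ssubset).2 ⟨y, Finset.mem_univ _, lt_irrefl _⟩
  simpa [numBelow] using Finset.card_lt_card h

theorem numBelow_eq_zero {y : Fin N} : numBelow x y = 0 ↔ ¬ ∃ i, x i < x y := by
  simp [numBelow, Finset.filter_eq_empty_iff]

/-- Bound for the expected remaining cost of the main loop when `t` items lie below the
threshold. -/
def loopCost (N t : ℕ) (m : ℝ) : ℝ :=
  (if m = 1 then searchCost N t else searchPotential N t m) + descentCost (Nat.clog 2 N) N t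

theorem loopCost_nonneg {t : ℕ} (ht : 0 < t) (htN : t < N) {m : ℝ} (hm : 1 ≤ m) :
    0 ≤ loopCost N t m := by
  refine add_nonneg ?_ (descentCost_nonneg (Nat.cast_nonneg _) _)
  split_ifs
  · exact searchCost_nonneg _ _
  · exact searchPotential_nonneg ht htN (by linarith)

theorem six_fifths_le_sqrt {N : ℕ} (hN : 2 ≤ N) : (6 / 5 : ℝ) ≤ Real.sqrt N := by
  refine Real.le_sqrt_of_sq_le ?_
  have : (2 : ℝ) ≤ N := by exact_mod_cast hN
  linarith

/-- Balance of one round: mean cost, plus the remaining cost after failure, corrected on success to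
the cost of the descent. The case `m = 1` is separate because a fresh search is charged
`searchCost`; no later parameter equals `1`. -/
theorem loopCost_step {t : ℕ} (ht : 0 < t) (htN : t < N) {m : ℝ}
    (hm : m = 1 ∨ 6 / 5 ≤ m ∧ m ≤ Real.sqrt N) :
    (⌈m⌉₊ + 1) / 2 + loopCost N t (min (6 / 5 * m) (Real.sqrt N)) + searchProb N t ⌈m⌉₊ *
      (descentCost (Nat.clog 2 N) N t - loopCost N t (min (6 / 5 * m) (Real.sqrt N))) ≤
      loopCost N t m := by
  have h65 := six_fifths_le_sqrt (N := N) (by omega)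
  have hm' : min (6 / 5 * m) (Real.sqrt N) ≠ 1 := by
    refine ne_of_gt (lt_min ?_ (by linarith))
    rcases hm with rfl | h <;> linarith
  rw [loopCost, loopCost, if_neg hm']
  rcases hm with rfl | ⟨hm1, hm2⟩
  · rw [if_pos rfl, Nat.ceil_one, searchProb_one htN, mul_one, min_eq_left h65]
    have := searchPotential_start ht htN
    push_cast
    linarith
  · rw [if_neg (by linarith)]
    have := searchPotential_step ht htN (by linarith) hm2
    linarith

theorem sum_thresholdCost_le (y : Fin N) (hy : 0 < numBelow x y) :
    (∑ i ∈ Finset.univ.filter (fun i => x i < x y),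
      thresholdCost (Nat.clog 2 N) N (numBelow x i)) / numBelow x y ≤
      descentCost (Nat.clog 2 N) N (numBelow x y) := by
  rw [div_le_iff₀' (Nat.cast_pos.2 hy), mul_descentCost]
  refine (Finset.sum_congr rfl fun i hi => ?_).trans_le
    (sum_card_lt_le x (thresholdCost_mono (Nat.cast_nonneg _))
      (Finset.univ.filter fun i => x i < x y))
  congr 2
  rw [numBelow, Finset.filter_filter]
  congr 1
  ext k
  simp only [Finset.mem_filter, Finset.mem_univ, true_and] at hi ⊢
  exact ⟨fun h => ⟨h.trans hi, h⟩, fun h => h.2⟩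

variable [NeZero N]

/-- The average over one measurement of a quantity that is `w i` at the marked items and `R` at
the others. -/
theorem sum_born_mul {marked : Fin N → Prop} [DecidablePred marked] {t : ℕ}
    (hcard : (Finset.univ.filter marked).card = t) (ht : 0 < t) (htN : t < N) (j : ℕ)
    (w : Fin N → ℝ) (e R : ℝ) :
    ∑ i, ‖groverState marked j i‖ ^ 2 * (e + if marked i then w i else R) =
      e + R + Real.sin ((2 * j + 1) * groverAngle N t) ^ 2 *
        ((∑ i ∈ Finset.univ.filter marked, w i) / t - R) := by
  have ht0 : (0 : ℝ) < t := Nat.cast_pos.2 ht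
  have hu0 : (0 : ℝ) < N - t := by
    rw [sub_pos]
    exact_mod_cast htN
  have hc' : (Finset.univ.filter fun k => ¬ marked k).card = N - t := by
    have := Finset.card_filter_add_card_filter_not (s := (Finset.univ : Finset (Fin N))) marked
    rw [hcard, Finset.card_univ, Fintype.card_fin] at this
    omega
  have h1 : ∀ i, ‖groverState marked j i‖ ^ 2 * (e + if marked i then w i else R) =
      if marked i then Real.sin ((2 * j + 1) * groverAngle N t) ^ 2 / t * (e + w i)
      else Real.cos ((2 * j + 1) * groverAngle N t) ^ 2 / (N - t) * (e + R) := by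
    intro i
    rw [groverState_apply marked (by convert hcard) ht htN, Complex.norm_real, Real.norm_eq_abs,
      sq_abs]
    split_ifs
    · rw [div_pow, Real.sq_sqrt ht0.le]
    · rw [div_pow, Real.sq_sqrt hu0.le]
  rw [Finset.sum_congr rfl fun i _ => h1 i, Finset.sum_ite, Finset.sum_const, hc', nsmul_eq_mul,
    ← Finset.mul_sum, Finset.sum_add_distrib, Finset.sum_const, hcard, nsmul_eq_mul,
    Nat.cast_sub htN.le, Real.cos_sq']
  field_simp
  ring

/-- Averaging over the uniform iteration count: the mean of `j + 1` is `(M + 1)/2`, and the sine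
squares average to the success probability. -/
theorem sum_range_add_one (M : ℕ) (hM : 0 < M) (e : ℝ) (f : ℕ → ℝ) (A R : ℝ) :
    (∑ j ∈ Finset.range M, (e + (j + 1) + R + f j * (A - R))) / M =
      e + (M + 1) / 2 + R + (∑ j ∈ Finset.range M, f j) / M * (A - R) := by
  have hM0 : (0 : ℝ) < M := Nat.cast_pos.2 hM
  have h : ∑ j ∈ Finset.range M, ((j : ℝ) + 1) = M * (M + 1) / 2 := by
    clear hM hM0
    induction M with
    | zero => simp
    | succ M ih =>
      rw [Finset.sum_range_succ, ih]
      push_cast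
      ring
  rw [Finset.sum_add_distrib, ← Finset.sum_mul, Finset.sum_add_distrib, Finset.sum_add_distrib, h,
    Finset.sum_const, Finset.sum_const, Finset.card_range, nsmul_eq_mul, nsmul_eq_mul]
  field_simp

theorem cutoff_pos : 0 < cutoff N := by
  have hN : (0 : ℝ) < N := Nat.cast_pos.2 (Nat.pos_of_neZero N)
  rw [cutoff]
  have := Real.sqrt_pos.2 hN
  positivity

theorem prob_minSearchLoop_of_min (rounds : ℕ) (y : Fin N) (m : ℝ) (elapsed : ℕ)
    (hy : ¬ ∃ i, x i < x y) :
    ((minSearchLoop x rounds y m elapsed).prob fun y' => ∃ i, x i < x y') = 0 := by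
  induction rounds generalizing m elapsed with
  | zero =>
    rw [minSearchLoop]
    exact Timed.prob_pure_of_not hy
  | succ r ih =>
    rw [minSearchLoop]
    split_ifs
    · exact Timed.prob_pure_of_not hy
    · rw [Timed.prob_sample_bind]
      refine ENNReal.tsum_eq_zero.2 fun j => mul_eq_zero_of_right _ ?_
      rw [Timed.prob_sample_bind]
      refine ENNReal.tsum_eq_zero.2 fun i => mul_eq_zero_of_right _ ?_
      rw [Timed.prob_tick_bind, if_neg fun h => hy ⟨i, h⟩]
      exact ih _ _

/-- The failure probability of the main loop, by Markov's inequality for the total cost. -/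
theorem prob_minSearchLoop_le (rounds : ℕ) (y : Fin N) (m : ℝ) (elapsed : ℕ)
    (hr : ⌊cutoff N⌋₊ + 1 ≤ rounds + elapsed) (hm : m = 1 ∨ 6 / 5 ≤ m ∧ m ≤ Real.sqrt N)
    (hy : 0 < numBelow x y) :
    ((minSearchLoop x rounds y m elapsed).prob fun y' => ∃ i, x i < x y') ≤
      ENNReal.ofReal ((elapsed + loopCost N (numBelow x y) m) / cutoff N) := by
  have hc : 0 < cutoff N := cutoff_pos
  induction rounds generalizing y m elapsed with
  | zero =>
    have h1 : 1 ≤ m := by rcases hm with rfl | h <;> linarith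
    -- Out of rounds: `hr` puts `elapsed` beyond the cutoff, so the claimed bound is at least `1`.
    refine (Timed.prob_le_one _ _).trans ?_
    rw [ENNReal.one_le_ofReal, one_le_div hc]
    have h2 : ((⌊cutoff N⌋₊ : ℕ) : ℝ) + 1 ≤ elapsed := by
      rw [zero_add] at hr
      exact_mod_cast hr
    linarith [Nat.lt_floor_add_one (cutoff N), loopCost_nonneg hy (numBelow_lt x y) h1]
  | succ r ih =>
    have h1 : 1 ≤ m := by rcases hm with rfl | h <;> linarith
    have htN := numBelow_lt x y
    set t := numBelow x y with ht
    have h65 := six_fifths_le_sqrt (N := N) (by omega)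
    have hL := loopCost_nonneg hy htN h1
    rw [minSearchLoop]
    split_ifs with hcut
    · refine (Timed.prob_le_one _ _).trans ?_
      rw [ENNReal.one_le_ofReal, one_le_div hc]
      linarith
    set M := ⌈m⌉₊ with hM
    have hM0 : 0 < M := Nat.ceil_pos.2 (by linarith)
    have hM1 : M - 1 + 1 = M := by omega
    set m' := min (6 / 5 * m) (Real.sqrt N) with hm'
    have hm'1 : 6 / 5 ≤ m' := le_min (by linarith) h65
    set R := loopCost N t m' with hR
    have hR0 : 0 ≤ R := loopCost_nonneg hy htN (by linarith)
    set w : Fin N → ℝ := fun i => thresholdCost (Nat.clog 2 N) N (numBelow x i) with hw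
    have hw0 : ∀ i, 0 ≤ w i := fun i => thresholdCost_nonneg (Nat.cast_nonneg _) _
    rw [iterationCount_eq_map, Timed.prob_sample_map_bind, tsum_fintype]
    -- For a fixed iteration count, the induction hypothesis is linear in the remaining cost, so
    -- Born averaging applies to it directly.
    have hround : ∀ j : Fin (M - 1 + 1),
        PMF.uniformOfFintype (Fin (M - 1 + 1)) j *
          (Timed.sample (born (groverState (fun i => x i < x y) j) (norm_groverState _ j)) >>=
            fun i => Timed.tick (j + 1) >>= fun _ =>
              if x i < x y then Timed.tick (Nat.clog 2 N) >>= fun _ =>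
                minSearchLoop x r i 1 (elapsed + (j + 1) + Nat.clog 2 N)
              else minSearchLoop x r y m' (elapsed + (j + 1))).prob
            (fun y' => ∃ i, x i < x y') ≤
        ENNReal.ofReal ((elapsed + ((j : ℕ) + 1) + R +
          Real.sin ((2 * (j : ℕ) + 1) * groverAngle N t) ^ 2 *
            ((∑ i ∈ Finset.univ.filter (fun i => x i < x y), w i) / t - R)) /
              (M * cutoff N)) := by
      intro j
      rw [Timed.prob_sample_bind, tsum_fintype,
        ← sum_born_mul (marked := fun i => x i < x y) (by rw [ht, numBelow]) hy htN,
        mul_comm (M : ℝ), ← div_div, ENNReal.ofReal_div_of_pos (Nat.cast_pos.2 hM0),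
        PMF.uniformOfFintype_apply, Fintype.card_fin, congrArg (Nat.cast (R := ℝ≥0∞)) hM1,
        ENNReal.ofReal_natCast, ENNReal.div_eq_inv_mul, Finset.sum_div, ENNReal.ofReal_sum_of_nonneg]
      · refine mul_le_mul_right (Finset.sum_le_sum fun i _ => ?_) _
        rw [born, PMF.ofFintype_apply, mul_div_assoc, ENNReal.ofReal_mul (by positivity)]
        refine mul_le_mul_right ?_ _
        rw [Timed.prob_tick_bind]
        split_ifs with hi
        · rw [Timed.prob_tick_bind]
          -- Once the minimum is the threshold, failure is impossible; hence `thresholdCost` is `0`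
          -- there, without a charge for the start of the useless last search.
          rcases Nat.eq_zero_or_pos (numBelow x i) with h0 | h0
          · rw [prob_minSearchLoop_of_min _ _ _ _ _ ((numBelow_eq_zero x).1 h0)]
            exact zero_le
          · refine (ih i 1 _ (by omega) (Or.inl rfl) h0).trans (le_of_eq ?_)
            congr 2
            rw [hw, loopCost, if_pos rfl]
            simp only [thresholdCost, if_neg h0.ne']
            push_cast
            ring
        · refine (ih y m' _ (by omega) (Or.inr ⟨hm'1, min_le_right _ _⟩) hy).trans (le_of_eq ?_)
          push_cast
          rfl
      · intro i _
        refine div_nonneg (mul_nonneg (by positivity) ?_) hc.le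
        have := hw0 i
        split_ifs <;> positivity
    refine (Finset.sum_le_sum fun j _ => hround j).trans ?_
    have hnn : ∀ j : ℕ, 0 ≤ (elapsed + ((j : ℕ) + 1) + R +
          Real.sin ((2 * (j : ℕ) + 1) * groverAngle N t) ^ 2 *
            ((∑ i ∈ Finset.univ.filter (fun i => x i < x y), w i) / t - R)) /
              (M * cutoff N) := by
      intro j
      have h2 := Real.sin_sq_le_one ((2 * (j : ℕ) + 1) * groverAngle N t)
      have h3 : 0 ≤ (∑ i ∈ Finset.univ.filter (fun i => x i < x y), w i) / t :=
        div_nonneg (Finset.sum_nonneg fun i _ => hw0 i) (Nat.cast_nonneg _)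
      refine div_nonneg ?_ (by positivity)
      have h4 : 0 ≤ Real.sin ((2 * (j : ℕ) + 1) * groverAngle N t) ^ 2 *
        ((∑ i ∈ Finset.univ.filter (fun i => x i < x y), w i) / t) := by positivity
      have h5 := mul_le_of_le_one_left hR0 h2
      have h6 : (0 : ℝ) ≤ elapsed + ((j : ℕ) + 1) := by positivity
      linarith
    rw [← ENNReal.ofReal_sum_of_nonneg fun (j : Fin (M - 1 + 1)) _ => hnn j]
    refine ENNReal.ofReal_le_ofReal ?_
    rw [Fin.sum_univ_eq_sum_range (fun j : ℕ => (elapsed + ((j : ℕ) + 1) + R +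
          Real.sin ((2 * (j : ℕ) + 1) * groverAngle N t) ^ 2 *
            ((∑ i ∈ Finset.univ.filter (fun i => x i < x y), w i) / t - R)) /
              (M * cutoff N)), hM1, ← Finset.sum_div, ← div_div, sum_range_add_one M hM0]
    refine div_le_div_of_nonneg_right ?_ hc.le
    have hP0 : 0 ≤ searchProb N t M := by
      rw [searchProb]
      positivity
    have h7 := mul_le_mul_of_nonneg_left (sub_le_sub_right (sum_thresholdCost_le x y hy) R) hP0
    have h8 := loopCost_step hy htN hm
    rw [searchProb] at h7 h8
    linarith

end loop

/-! ### Failure of a complete minimum search and of its repetition -/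

section minSearch

variable {N : ℕ} [NeZero N] (x : Fin N → ℕ∞)

/-- The bound for the failure probability of one minimum search. Its square is below `1 / 8`. -/
def failBound : ℝ≥0∞ := ENNReal.ofReal (7 / 20 * (101 / 100))

/-- The uniform first threshold acts like one more descent step from `N` items, so averaging the
loop bound gives `descentCost` at `N`. -/
theorem prob_minSearch_le : ((minSearch x).prob fun v => ∃ i, x i < v) ≤ failBound := by
  have hc : 0 < cutoff N := cutoff_pos
  have hN : 0 < N := Nat.pos_of_neZero N
  have hN0 : (0 : ℝ) < N := Nat.cast_pos.2 hN
  have hκ : (0 : ℝ) ≤ Nat.clog 2 N := Nat.cast_nonneg _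
  rw [minSearch, Timed.prob_sample_bind, tsum_fintype]
  have hround : ∀ y : Fin N, PMF.uniformOfFintype (Fin N) y *
      (Timed.tick (Nat.clog 2 N + 1) >>= fun _ =>
        minSearchLoop x (⌊cutoff N⌋₊ + 1) y 1 (Nat.clog 2 N) >>= fun y' => pure (x y')).prob
        (fun v => ∃ i, x i < v) ≤
      ENNReal.ofReal (thresholdCost (Nat.clog 2 N) N (numBelow x y) / (N * cutoff N)) := by
    intro y
    rw [Timed.prob_tick_bind, Timed.prob_bind_pure, PMF.uniformOfFintype_apply, Fintype.card_fin,
      mul_comm (N : ℝ), ← div_div, ENNReal.ofReal_div_of_pos hN0, ENNReal.ofReal_natCast,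
      ENNReal.div_eq_inv_mul]
    refine mul_le_mul_right ?_ _
    rcases Nat.eq_zero_or_pos (numBelow x y) with h0 | h0
    · rw [prob_minSearchLoop_of_min _ _ _ _ _ ((numBelow_eq_zero x).1 h0)]
      exact zero_le
    · refine (prob_minSearchLoop_le x _ y 1 _ (by omega) (Or.inl rfl) h0).trans (le_of_eq ?_)
      rw [loopCost, if_pos rfl, thresholdCost, if_neg h0.ne', add_assoc]
  refine (Finset.sum_le_sum fun y _ => hround y).trans ?_
  rw [← ENNReal.ofReal_sum_of_nonneg fun y _ =>
    div_nonneg (thresholdCost_nonneg hκ _) (by positivity), ← Finset.sum_div, failBound]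
  refine ENNReal.ofReal_le_ofReal ?_
  rw [div_le_iff₀ (by positivity)]
  have h1 : ∑ y, thresholdCost (Nat.clog 2 N) N (numBelow x y) ≤
      N * descentCost (Nat.clog 2 N) N N := by
    rw [mul_descentCost]
    have := sum_card_lt_le x (thresholdCost_mono hκ (N := N)) Finset.univ
    rwa [Finset.card_univ, Fintype.card_fin] at this
  rcases Nat.lt_or_ge 1 N with h2 | h2
  · have h3 := start_cost_le h2
    have h4 : (0 : ℝ) ≤ Nat.clog 2 N / N := by positivity
    calc _ ≤ _ := h1
      _ ≤ N * (7 / 20 * (101 / 100) * cutoff N) := by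
        gcongr
        linarith
      _ = _ := by ring
  · obtain rfl : N = 1 := by omega
    have : descentCost (Nat.clog 2 1) 1 1 = 0 := by simp [descentCost]
    rw [this, mul_zero] at h1
    exact h1.trans (by positivity)

theorem minSearch_mem_range {a : ℕ∞ × ℕ} (ha : a ∈ (minSearch x).law.support) :
    ∃ i, x i = a.1 := by
  rw [minSearch] at ha
  obtain ⟨_, _, c₁, h₁, rfl⟩ := Timed.mem_support_bind.1 ha
  obtain ⟨_, _, c₂, h₂, rfl⟩ := Timed.mem_support_bind.1 h₁
  obtain ⟨b, _, c, hc, rfl⟩ := Timed.mem_support_bind.1 h₂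
  rw [Timed.law_pure, PMF.support_pure, Set.mem_singleton_iff] at hc
  exact ⟨b.1, by rw [hc]⟩

theorem iInf_le_boostedMinSearch (k : ℕ) {a : ℕ∞ × ℕ}
    (ha : a ∈ (boostedMinSearch x k).law.support) : ⨅ i, x i ≤ a.1 := by
  induction k generalizing a with
  | zero =>
    rw [boostedMinSearch, Timed.law_pure, PMF.support_pure, Set.mem_singleton_iff] at ha
    rw [ha]
    exact le_top
  | succ k ih =>
    rw [boostedMinSearch] at ha
    obtain ⟨b, hb, c₁, h₁, rfl⟩ := Timed.mem_support_bind.1 ha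
    obtain ⟨d, hd, c₂, h₂, rfl⟩ := Timed.mem_support_bind.1 h₁
    obtain ⟨_, _, c, hc, rfl⟩ := Timed.mem_support_bind.1 h₂
    rw [Timed.law_pure, PMF.support_pure, Set.mem_singleton_iff] at hc
    rw [hc]
    obtain ⟨i, hi⟩ := minSearch_mem_range x hb
    exact le_min ((iInf_le x i).trans_eq hi) (ih hd)

theorem prob_boostedMinSearch_le (k : ℕ) :
    ((boostedMinSearch x k).prob fun v => ∃ i, x i < v) ≤ failBound ^ k := by
  induction k with
  | zero => exact (Timed.prob_le_one _ _).trans_eq (pow_zero _).symm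
  | succ k ih =>
    rw [boostedMinSearch, pow_succ']
    have e : ∀ a : ℕ∞, ((boostedMinSearch x k >>= fun b => Timed.tick 1 >>= fun _ =>
        pure (min a b)) : Timed ℕ∞).prob (fun v => ∃ i, x i < v) =
        (boostedMinSearch x k).prob fun b => ∃ i, x i < min a b := by
      intro a
      have := Timed.prob_bind_pure (boostedMinSearch x k) (fun b => min a b)
        fun v => ∃ i, x i < v
      rw [← this, Timed.prob_bind, Timed.prob_bind]
      simp only [Timed.prob_tick_bind]
    refine Timed.prob_bind_le_mul (prob_minSearch_le x) (fun a _ _ => ?_) fun a _ ha => ?_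
    · rw [e]
      refine (Timed.prob_mono _ fun b _ hb => ?_).trans ih
      obtain ⟨i, hi⟩ := hb
      exact ⟨i, hi.trans_le (min_le_right _ _)⟩
    · rw [e, ← nonpos_iff_eq_zero]
      refine (Timed.prob_mono (Q := fun _ => False) _ fun b _ hb => ?_).trans_eq ?_
      · obtain ⟨i, hi⟩ := hb
        exact ha ⟨i, hi.trans_le (min_le_left _ _)⟩
      · simp [Timed.prob]

end minSearch

theorem prob_boostedMin_le (k : ℕ) (l : List ℕ∞) :
    ((boostedMin k l).prob fun v => ¬ v = sInf {a | a ∈ l}) ≤ failBound ^ k := by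
  rw [boostedMin]
  split_ifs with h
  · rw [Timed.prob_tick_bind, Timed.prob_pure_of_not]
    · exact zero_le
    · simp [h]
  · have : NeZero l.length := ⟨fun h0 => h (List.length_eq_zero_iff.1 h0)⟩
    refine (Timed.prob_mono _ fun a ha hne => ?_).trans (prob_boostedMinSearch_le _ k)
    have e : sInf {a | a ∈ l} = ⨅ j : Fin l.length, l.get j := by
      rw [iInf, Set.range_list_get]
    rw [e] at hne
    exact iInf_lt_iff.1 (lt_of_le_of_ne (iInf_le_boostedMinSearch _ k ha) (Ne.symm hne))

/-- The squared bound is below `1/8`, so the square of the `k`-th power is at most `(2^(-k))³`,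
while `2^k ≥ n²`. Comparing squares avoids the irrational `2^(-3/2)`. -/
theorem failBound_pow_boostCount_le {n : ℕ} (hn : 1 ≤ n) :
    failBound ^ boostCount n ≤ ENNReal.ofReal (1 / n ^ 3) := by
  have hn0 : (0 : ℝ) < n := Nat.cast_pos.2 hn
  rw [failBound, ← ENNReal.ofReal_pow (by norm_num)]
  refine ENNReal.ofReal_le_ofReal ?_
  set k := boostCount n with hk
  have h1 : ((n : ℝ) ^ 2) ≤ 2 ^ k := by
    have h2 : 2 * Real.logb 2 n ≤ k := Nat.le_ceil _
    calc (n : ℝ) ^ 2 = (2 : ℝ) ^ (2 * Real.logb 2 n) := by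
          rw [mul_comm, Real.rpow_mul two_pos.le, Real.rpow_logb two_pos (by norm_num) hn0]
          norm_num
      _ ≤ (2 : ℝ) ^ (k : ℝ) := Real.rpow_le_rpow_of_exponent_le one_le_two h2
      _ = 2 ^ k := Real.rpow_natCast _ _
  rw [← one_div_pow]
  refine (sq_le_sq₀ (by positivity) (by positivity)).1 ?_
  calc ((7 / 20 * (101 / 100) : ℝ) ^ k) ^ 2 = ((7 / 20 * (101 / 100) : ℝ) ^ 2) ^ k := by
        rw [← pow_mul, ← pow_mul, mul_comm k 2]
    _ ≤ ((1 / 2) ^ 3) ^ k := by gcongr; norm_num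
    _ = (1 / 2 ^ k) ^ 3 := by rw [← pow_mul, mul_comm 3 k, pow_mul, one_div_pow]
    _ ≤ (1 / n ^ 2) ^ 3 := by gcongr
    _ = ((1 / n) ^ 3) ^ 2 := by field_simp

/-! ### Running times -/

theorem Timed.TimeLE.bind_pure {α β : Type} {p : Timed α} {S : ℝ} (hp : p.TimeLE S) (g : α → β) :
    (p >>= fun a => pure (g a)).TimeLE S :=
  (hp.bind fun a _ => Timed.timeLE_pure (g a.1)).mono (add_zero S).le

section minSearchTime

variable {N : ℕ} [NeZero N] (x : Fin N → ℕ∞)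

theorem one_le_sqrt_natCast : 1 ≤ Real.sqrt N := by
  rw [Real.one_le_sqrt]
  exact_mod_cast Nat.pos_of_neZero N

/-- The main loop stops at most one round after the cutoff. -/
theorem timeLE_minSearchLoop (rounds : ℕ) (y : Fin N) (m : ℝ) (elapsed : ℕ)
    (hm : m ≤ Real.sqrt N) :
    (minSearchLoop x rounds y m elapsed).TimeLE
      (max (elapsed : ℝ) (cutoff N + Real.sqrt N + 1 + Nat.clog 2 N) - elapsed) := by
  induction rounds generalizing y m elapsed with
  | zero =>
    rw [minSearchLoop]
    exact (Timed.timeLE_pure _).mono (sub_nonneg.2 (le_max_left _ _))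
  | succ r ih =>
    rw [minSearchLoop]
    split_ifs with hcut
    · exact (Timed.timeLE_pure _).mono (sub_nonneg.2 (le_max_left _ _))
    · refine Timed.timeLE_sample_bind fun j hj => Timed.timeLE_sample_bind fun i _ => ?_
      rw [iterationCount_eq_map, PMF.mem_support_map_iff] at hj
      obtain ⟨j, -, rfl⟩ := hj
      set B := cutoff N + Real.sqrt N + 1 + Nat.clog 2 N with hB
      have h1 : (1 : ℝ) ≤ Real.sqrt N := one_le_sqrt_natCast
      have hj : ((j : ℕ) : ℝ) + 1 ≤ Real.sqrt N + 1 := by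
        have h2 : (j : ℕ) + 1 ≤ max 1 ⌈m⌉₊ := by
          have := j.2
          omega
        have h3 : (⌈m⌉₊ : ℝ) ≤ Real.sqrt N + 1 :=
          (Nat.cast_le.2 (Nat.ceil_mono hm)).trans (Nat.ceil_lt_add_one (by linarith)).le
        calc ((j : ℕ) : ℝ) + 1 = (((j : ℕ) + 1 : ℕ) : ℝ) := by push_cast; rfl
          _ ≤ ((max 1 ⌈m⌉₊ : ℕ) : ℝ) := Nat.cast_le.2 h2
          _ ≤ Real.sqrt N + 1 := by
            rw [Nat.cast_max]
            refine max_le ?_ h3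
            push_cast
            linarith
      have hκ : (0 : ℝ) ≤ Nat.clog 2 N := Nat.cast_nonneg _
      have hcut' := not_lt.1 hcut
      refine (Timed.timeLE_tick_bind (T := B - elapsed - ((j : ℕ) + 1)) ?_).mono ?_
      · split_ifs with hi
        · refine (Timed.timeLE_tick_bind (ih i 1 _ h1)).mono ?_
          rw [max_eq_right]
          · push_cast
            linarith
          · push_cast
            linarith
        · refine (ih y _ _ (min_le_right _ _)).mono ?_
          rw [max_eq_right]
          · push_cast
            linarith
          · push_cast
            linarith
      · push_cast
        linarith [le_max_right (elapsed : ℝ) B]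

/-- From `log x ≤ 4 x^(1/4)` and `4 / log 2 < 6`; it absorbs the logarithmic part of the cutoff into
`√N`. -/
theorem logb_sq_le : Real.logb 2 N ^ 2 ≤ 36 * Real.sqrt N := by
  have hN : (0 : ℝ) < N := Nat.cast_pos.2 (Nat.pos_of_neZero N)
  have hN1 : (1 : ℝ) ≤ N := by exact_mod_cast Nat.pos_of_neZero N
  have h1 := Real.log_le_rpow_div hN.le (show (0 : ℝ) < 1 / 4 by norm_num)
  have h2 : ((N : ℝ) ^ (1 / 4 : ℝ)) ^ 2 = Real.sqrt N := by
    rw [← Real.rpow_natCast, ← Real.rpow_mul hN.le, Real.sqrt_eq_rpow]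
    norm_num
  have hl := Real.log_two_gt_d9
  have h3 : Real.logb 2 N ≤ 6 * (N : ℝ) ^ (1 / 4 : ℝ) := by
    rw [Real.logb, div_le_iff₀ (by linarith)]
    have : (0 : ℝ) ≤ (N : ℝ) ^ (1 / 4 : ℝ) := by positivity
    nlinarith
  calc Real.logb 2 N ^ 2 ≤ (6 * (N : ℝ) ^ (1 / 4 : ℝ)) ^ 2 :=
        pow_le_pow_left₀ (Real.logb_nonneg one_lt_two hN1) h3 2
    _ = 36 * Real.sqrt N := by rw [mul_pow, h2]; norm_num

theorem timeLE_minSearch : (minSearch x).TimeLE (120 * Real.sqrt N) := by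
  have hq : (1 : ℝ) ≤ Real.sqrt N := one_le_sqrt_natCast
  have hκ := clog_le_logb_add_one (N := N) (Nat.pos_of_neZero N)
  have hL := logb_sq_le (N := N)
  have hκ0 : (0 : ℝ) ≤ Nat.clog 2 N := Nat.cast_nonneg _
  have hc : 0 < cutoff N := cutoff_pos
  rw [minSearch]
  refine Timed.timeLE_sample_bind fun y _ => (Timed.timeLE_tick_bind
    ((timeLE_minSearchLoop x _ y 1 _ hq).bind_pure _)).mono ?_
  rw [max_eq_right (by linarith), cutoff]
  push_cast
  nlinarith [sq_nonneg (Real.logb 2 N - 1)]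

theorem timeLE_boostedMinSearch (k : ℕ) :
    (boostedMinSearch x k).TimeLE (k * (120 * Real.sqrt N + 1)) := by
  induction k with
  | zero =>
    rw [boostedMinSearch]
    simpa using Timed.timeLE_pure (⊤ : ℕ∞)
  | succ k ih =>
    rw [boostedMinSearch]
    refine ((timeLE_minSearch x).bind fun _ _ => ih.bind fun _ _ =>
      (Timed.timeLE_tick 1).bind_pure fun _ => _).mono (le_of_eq ?_)
    push_cast
    ring

end minSearchTime

theorem timeLE_boostedMin (k : ℕ) (l : List ℕ∞) :
    (boostedMin k l).TimeLE (k * (120 * Real.sqrt l.length + 1) + 1) := by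
  have h0 : (0 : ℝ) ≤ k * (120 * Real.sqrt l.length + 1) := by positivity
  rw [boostedMin]
  split_ifs with h
  · refine ((Timed.timeLE_tick 1).bind_pure fun _ => _).mono ?_
    push_cast
    linarith
  · have : NeZero l.length := ⟨fun h0 => h (List.length_eq_zero_iff.1 h0)⟩
    exact (timeLE_boostedMinSearch _ k).mono (by linarith)

section graphTime

variable {n : ℕ} (G : AdjGraph n)

theorem timeLE_processVertex (s : (Fin n → ℕ∞) × WithBot ℕ) (i : Fin n) :
    (processVertex G s i).TimeLE
      (boostCount n * (120 * Real.sqrt (G.inList i).length + 1) + 2) := by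
  rw [processVertex]
  refine ((timeLE_boostedMin _ _).bind fun _ _ =>
    (Timed.timeLE_tick 1).bind_pure fun _ => _).mono (le_of_eq ?_)
  rw [List.length_map]
  push_cast
  ring

theorem sum_length_inList : ∑ v, (G.inList v).length = G.numEdges := by
  classical
  have h1 : ∀ v, (G.inList v).length = ∑ u, if v ∈ G.out u then 1 else 0 := by
    intro v
    have hnd : (G.inList v).Nodup := (List.nodup_finRange n).filter _
    rw [← Finset.card_filter, ← List.toFinset_card_of_nodup hnd]
    congr 1
    ext u
    simp [AdjGraph.inList]
  have h2 : ∀ u, (G.out u).length = ∑ v, if v ∈ G.out u then 1 else 0 := by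
    intro u
    rw [← Finset.card_filter, ← List.toFinset_card_of_nodup (G.nodup u)]
    congr 1
    ext v
    simp
  rw [AdjGraph.numEdges, Finset.sum_congr rfl fun v _ => h1 v, Finset.sum_comm]
  exact Finset.sum_congr rfl fun u _ => (h2 u).symm

/-- Cauchy–Schwarz against the constant vector, with the in-degrees summing to `m`. -/
theorem sum_sqrt_length_inList_le :
    ∑ v, Real.sqrt (G.inList v).length ≤ Real.sqrt (n * G.numEdges) := by
  refine Real.le_sqrt_of_sq_le ?_
  refine (sq_sum_le_card_mul_sum_sq).trans (le_of_eq ?_)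
  rw [Finset.card_univ, Fintype.card_fin, ← sum_length_inList, Nat.cast_sum]
  congr 1
  exact Finset.sum_congr rfl fun v _ => Real.sq_sqrt (Nat.cast_nonneg _)

theorem sum_map_le_sum_univ {l : List (Fin n)} (hl : l.Nodup) {T : Fin n → ℝ}
    (hT : ∀ v, 0 ≤ T v) : (l.map T).sum ≤ ∑ v, T v := by
  rw [← List.sum_toFinset T hl]
  exact Finset.sum_le_sum_of_subset_of_nonneg (Finset.subset_univ _) fun v _ _ => hT v

theorem timeLE_processSource (z : Fin n) {later : List (Fin n)} (hl : later.Nodup)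
    (M : WithBot ℕ) : (processSource G z later M).TimeLE
      (3 * n + boostCount n * (120 * Real.sqrt (n * G.numEdges) + n)) := by
  rw [processSource]
  refine (Timed.timeLE_tick_bind ((Timed.timeLE_foldlM later
    (fun s i _ => timeLE_processVertex G s i) _).bind_pure _)).mono ?_
  have h1 := sum_map_le_sum_univ hl
    (T := fun i => boostCount n * (120 * Real.sqrt (G.inList i).length + 1) + 2)
    fun v => by positivity
  have h2 : ∑ i, ((boostCount n : ℝ) * (120 * Real.sqrt (G.inList i).length + 1) + 2) =
      boostCount n * (120 * ∑ i, Real.sqrt (G.inList i).length + n) + 2 * n := by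
    rw [Finset.sum_add_distrib, ← Finset.mul_sum, Finset.sum_add_distrib, ← Finset.mul_sum]
    simp [mul_comm]
  have h3 := sum_sqrt_length_inList_le G
  have h4 : (boostCount n : ℝ) * (120 * ∑ i, Real.sqrt (G.inList i).length + n) ≤
      boostCount n * (120 * Real.sqrt (n * G.numEdges) + n) := by
    gcongr
  linarith

end graphTime

/-! ### Paths and distances -/

namespace AdjGraph

variable {n : ℕ} {G : AdjGraph n}

theorem HasPath.trans {i j l : Fin n} {a b : ℕ} (h : G.HasPath i j a) (h' : G.HasPath j l b) :
    G.HasPath i l (a + b) := by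
  induction h with
  | nil => simpa using h'
  | cons hu _ ih =>
    rw [Nat.add_right_comm]
    exact .cons hu (ih h')

theorem HasPath.snoc {i j l : Fin n} {a : ℕ} (h : G.HasPath i j a) (hl : l ∈ G.out j) :
    G.HasPath i l (a + 1) :=
  h.trans (.cons hl (.nil l))

theorem HasPath.exists_last {i j : Fin n} {a : ℕ} (h : G.HasPath i j a) (ha : a ≠ 0) :
    ∃ u k, G.HasPath i u k ∧ j ∈ G.out u ∧ a = k + 1 := by
  induction h with
  | nil => exact absurd rfl ha
  | @cons i u j k hu hp ih =>
    rcases Nat.eq_zero_or_pos k with rfl | hk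
    · cases hp
      exact ⟨i, 0, .nil i, hu, rfl⟩
    · obtain ⟨v, l, hv, hj, rfl⟩ := ih hk.ne'
      exact ⟨v, l + 1, .cons hu hv, hj, rfl⟩

theorem mem_inList {u v : Fin n} : u ∈ G.inList v ↔ v ∈ G.out u := by
  simp [inList]

theorem nodup_inList (v : Fin n) : (G.inList v).Nodup :=
  (List.nodup_finRange n).filter _

theorem Acyclic.not_mem_out (hG : G.Acyclic) (v : Fin n) : v ∉ G.out v := fun h =>
  absurd (hG v 1 (.cons h (.nil v))) one_ne_zero

variable (G) in
/-- The length of a shortest path, and `⊤` if there is no path. -/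
def dist (i j : Fin n) : ℕ∞ := ⨅ (k : ℕ) (_ : G.HasPath i j k), (k : ℕ∞)

theorem dist_le {i j : Fin n} {k : ℕ} (h : G.HasPath i j k) : G.dist i j ≤ k := iInf₂_le k h

theorem exists_hasPath_of_dist_ne_top {i j : Fin n} (h : G.dist i j ≠ ⊤) :
    ∃ k, G.HasPath i j k ∧ G.dist i j = k ∧ ∀ l, G.HasPath i j l → k ≤ l := by
  classical
  have hex : ∃ k, G.HasPath i j k := by
    by_contra hc
    push Not at hc
    exact h (iInf₂_eq_top.2 fun k hk => absurd hk (hc k))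
  refine ⟨Nat.find hex, Nat.find_spec hex, le_antisymm (dist_le (Nat.find_spec hex)) ?_,
    fun l hl => Nat.find_min' hex hl⟩
  exact le_iInf₂ fun l hl => Nat.cast_le.2 (Nat.find_min' hex hl)

theorem dist_self (i : Fin n) : G.dist i i = 0 :=
  nonpos_iff_eq_zero.1 (by simpa using dist_le (HasPath.nil (G := G) i))

/-- Cut off the last edge of a path; the condition excludes the empty path. Unreachable vertices fit
in because the infimum of the empty set is `⊤` and `⊤ + 1 = ⊤`. -/
theorem dist_eq_sInf_add_one {i j : Fin n} (h : j ≠ i) :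
    G.dist i j = sInf {a | a ∈ (G.inList j).map (G.dist i)} + 1 := by
  refine le_antisymm ?_ (le_iInf₂ fun k hk => ?_)
  · by_cases hS : {a | a ∈ (G.inList j).map (G.dist i)}.Nonempty
    · obtain ⟨u, hu, hd⟩ := List.mem_map.1 (csInf_mem hS)
      rw [← hd]
      by_cases ht : G.dist i u = ⊤
      · simp [ht]
      · obtain ⟨k, hk, hdk, -⟩ := exists_hasPath_of_dist_ne_top ht
        rw [hdk]
        exact_mod_cast dist_le (hk.snoc (mem_inList.1 hu))
    · rw [Set.not_nonempty_iff_eq_empty.1 hS]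
      simp
  · have hk0 : k ≠ 0 := by
      rintro rfl
      cases hk
      exact h rfl
    obtain ⟨u, l, hl, hu, rfl⟩ := hk.exists_last hk0
    push_cast
    gcongr
    have hmem : G.dist i u ∈ {a | a ∈ (G.inList j).map (G.dist i)} :=
      List.mem_map_of_mem (mem_inList.2 hu)
    exact (sInf_le hmem).trans (dist_le hl)

/-- The contribution of the pair `(z, v)` to the maximal length of a shortest path. -/
def pathLen (G : AdjGraph n) (z v : Fin n) : WithBot ℕ :=
  open Classical in if G.dist z v = ⊤ then ⊥ else ((G.dist z v).toNat : WithBot ℕ)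

theorem len_eq_of_pathLen {z v : Fin n} {k : ℕ} (h : G.pathLen z v = k) : G.len z v = k := by
  classical
  rw [pathLen] at h
  split_ifs at h with hd
  · exact absurd h.symm WithBot.coe_ne_bot
  obtain ⟨l, hl, hdl, hmin⟩ := exists_hasPath_of_dist_ne_top hd
  rw [hdl, ENat.toNat_natCast] at h
  have hlk : l = k := by exact_mod_cast h
  subst hlk
  have hex : ∃ k, G.HasPath z v k := ⟨l, hl⟩
  rw [len, dif_pos hex, Nat.cast_inj]
  exact le_antisymm (Nat.find_min' _ hl) (hmin _ (Nat.find_spec hex))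

theorem len_eq_neg_one_or (z v : Fin n) :
    G.len z v = -1 ∨ ∃ k, G.HasPath z v k ∧ G.len z v = k ∧ G.pathLen z v = k := by
  classical
  by_cases hd : G.dist z v = ⊤
  · left
    rw [len, dif_neg]
    rintro ⟨k, hk⟩
    have := dist_le hk
    rw [hd, top_le_iff] at this
    exact ENat.natCast_ne_top k this
  · right
    obtain ⟨l, hl, hdl, -⟩ := exists_hasPath_of_dist_ne_top hd
    have hp : G.pathLen z v = l := by rw [pathLen, if_neg hd, hdl, ENat.toNat_natCast]
    exact ⟨l, hl, len_eq_of_pathLen hp, hp⟩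

variable (G) in
/-- A list of all vertices in topological order that starts with the non-sinks. -/
structure IsTopOrder (o : List (Fin n)) : Prop where
  nodup : o.Nodup
  mem : ∀ v, v ∈ o
  pairwise : o.Pairwise fun a b => a ∉ G.out b
  take : ∀ v ∈ o.take G.numNonSinks, G.out v ≠ []
  drop : ∀ v ∈ o.drop G.numNonSinks, G.out v = []

/-- No edge leads back from the rest of the order into a prefix, so a path that starts outside the
prefix never enters it. -/
theorem IsTopOrder.not_mem_of_hasPath {o pre rest : List (Fin n)} (ho : G.IsTopOrder o)
    (h : o = pre ++ rest) {i j : Fin n} {k : ℕ} (hk : G.HasPath i j k) (hi : i ∉ pre) :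
    j ∉ pre := by
  have hp := ho.pairwise
  rw [h, List.pairwise_append] at hp
  induction hk with
  | nil => exact hi
  | @cons i u j k hu _ ih =>
    refine ih fun hup => ?_
    have hi' : i ∈ rest := by
      have := ho.mem i
      rw [h, List.mem_append] at this
      exact this.resolve_left hi
    exact hp.2.2 u hup i hi' hu

end AdjGraph

open AdjGraph

/-! ### The run in which no search fails -/

section ideal

variable {n : ℕ} (G : AdjGraph n)

open Classical in
/-- The step of `processVertex` when the minimum search does not fail. -/
def idealStep (s : (Fin n → ℕ∞) × WithBot ℕ) (i : Fin n) : (Fin n → ℕ∞) × WithBot ℕ :=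
  let d : ℕ∞ := sInf {a | a ∈ (G.inList i).map s.1} + 1
  (Function.update s.1 i d, if d = ⊤ then s.2 else max s.2 (d.toNat : WithBot ℕ))

/-- The run from one source when no minimum search fails. -/
def idealSource (z : Fin n) (later : List (Fin n)) (M : WithBot ℕ) : WithBot ℕ :=
  (later.foldl (idealStep G) (Function.update (fun _ => ⊤) z 0, M)).2

/-- The runs from the sources when no minimum search fails. -/
def idealRun (o : List (Fin n)) (M : WithBot ℕ) (p : ℕ) : WithBot ℕ :=
  match o.drop p with
  | [] => M
  | z :: later => idealSource G z later M

theorem prob_processVertex_le (s : (Fin n → ℕ∞) × WithBot ℕ) (i : Fin n) :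
    ((processVertex G s i).prob fun s' => ¬ s' = idealStep G s i) ≤
      failBound ^ boostCount n := by
  rw [processVertex]
  refine (Timed.prob_bind_le (δ := 0) (prob_boostedMin_le _ _) ?_).trans_eq (add_zero _)
  rintro _ rfl
  rw [Timed.prob_tick_bind, Timed.prob_pure_of_not]
  rw [not_not, idealStep]

theorem prob_processSource_le (z : Fin n) (later : List (Fin n)) (M : WithBot ℕ) :
    ((processSource G z later M).prob fun M' => ¬ M' = idealSource G z later M) ≤
      later.length * failBound ^ boostCount n := by
  rw [processSource, Timed.prob_tick_bind, Timed.prob_bind_pure]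
  refine (Timed.prob_mono _ fun a _ h => ?_).trans
    (Timed.prob_foldlM_ne_le later (fun s i _ => prob_processVertex_le G s i) _)
  intro h'
  exact h (by rw [h', idealSource])

/-- Invariant: the array is exact outside the vertices still to be processed. The in-neighbours of
the current vertex are never among these, so its new entry is exact too. -/
theorem foldl_idealStep_snd {G : AdjGraph n} (hG : G.Acyclic) (z : Fin n) (l : List (Fin n))
    (hl : l.Pairwise fun a b => a ∉ G.out b) (hz : z ∉ l) (hnd : l.Nodup)
    (s : (Fin n → ℕ∞) × WithBot ℕ) (hs : ∀ v, v ∉ l → s.1 v = G.dist z v) :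
    (l.foldl (idealStep G) s).2 = l.foldl (fun M v => max M (G.pathLen z v)) s.2 := by
  classical
  induction l generalizing s with
  | nil => rfl
  | cons i l ih =>
    rw [List.pairwise_cons] at hl
    rw [List.nodup_cons] at hnd
    rw [List.mem_cons, not_or] at hz
    rw [List.foldl_cons, List.foldl_cons]
    have hmap : (G.inList i).map s.1 = (G.inList i).map (G.dist z) := by
      refine List.map_congr_left fun u hu => hs u ?_
      rw [mem_inList] at hu
      rw [List.mem_cons, not_or]
      refine ⟨?_, fun h => hl.1 u h hu⟩
      rintro rfl
      exact hG.not_mem_out u hu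
    have hd : sInf {a | a ∈ (G.inList i).map s.1} + 1 = G.dist z i := by
      rw [hmap, dist_eq_sInf_add_one (Ne.symm hz.1)]
    rw [ih hl.2 hz.2 hnd.2]
    · congr 1
      simp only [idealStep, hd, pathLen]
      split_ifs <;> simp
    · intro v hv
      simp only [idealStep, hd]
      by_cases hvi : v = i
      · rw [hvi, Function.update_self]
      · rw [Function.update_of_ne hvi]
        exact hs v (by simp [hvi, hv])

theorem idealSource_eq {G : AdjGraph n} (hG : G.Acyclic) {o : List (Fin n)}
    (ho : G.IsTopOrder o) {p : ℕ} {z : Fin n} {later : List (Fin n)} (h : o.drop p = z :: later)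
    (M : WithBot ℕ) :
    idealSource G z later M = later.foldl (fun M v => max M (G.pathLen z v)) M := by
  have hsplit : o = o.take p ++ z :: later := by rw [← h, List.take_append_drop]
  have hp := ho.pairwise
  have hn := ho.nodup
  rw [hsplit, List.pairwise_append, List.pairwise_cons] at hp
  rw [hsplit, List.nodup_append, List.nodup_cons] at hn
  refine foldl_idealStep_snd hG z later hp.2.1.2 hn.2.1.1 hn.2.1.2 _ fun v hv => ?_
  dsimp only
  by_cases hvz : v = z
  · rw [hvz, Function.update_self, dist_self]
  · rw [Function.update_of_ne hvz]
    have hvp : v ∈ o.take p := by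
      have := ho.mem v
      rw [hsplit] at this
      simpa [hvz, hv] using this
    refine (iInf₂_eq_top.2 fun k hk => absurd hvp
      (ho.not_mem_of_hasPath hsplit hk fun hzp => ?_)).symm
    exact hn.2.2 z hzp z (by simp) rfl

theorem le_foldl_max {ι : Type} (f : ι → WithBot ℕ) (l : List ι) (M : WithBot ℕ) :
    M ≤ l.foldl (fun M v => max M (f v)) M ∧
      (∀ v ∈ l, f v ≤ l.foldl (fun M v => max M (f v)) M) ∧
      (l.foldl (fun M v => max M (f v)) M = M ∨
        ∃ v ∈ l, l.foldl (fun M v => max M (f v)) M = f v) := by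
  induction l generalizing M with
  | nil => simp
  | cons i l ih =>
    rw [List.foldl_cons]
    obtain ⟨h1, h2, h3⟩ := ih (max M (f i))
    refine ⟨(le_max_left _ _).trans h1, ?_, ?_⟩
    · rintro v hv
      rcases List.mem_cons.1 hv with rfl | hv
      · exact (le_max_right _ _).trans h1
      · exact h2 v hv
    · rcases h3 with h3 | ⟨v, hv, h3⟩
      · rcases max_choice M (f i) with h | h
        · exact Or.inl (h3.trans h)
        · exact Or.inr ⟨i, by simp, h3.trans h⟩
      · exact Or.inr ⟨v, by simp [hv], h3⟩

/-- The result dominates all examined distances and is itself the initial value or one of the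
distances; these two facts give the two inequalities with the diameter. -/
theorem le_foldl_idealRun {G : AdjGraph n} (hG : G.Acyclic) {o : List (Fin n)}
    (ho : G.IsTopOrder o) (l : List ℕ) (M : WithBot ℕ) :
    M ≤ l.foldl (idealRun G o) M ∧
      (∀ p ∈ l, ∀ z later, o.drop p = z :: later → ∀ v ∈ later,
        G.pathLen z v ≤ l.foldl (idealRun G o) M) ∧
      (l.foldl (idealRun G o) M = M ∨ ∃ z v, l.foldl (idealRun G o) M = G.pathLen z v) := by
  induction l generalizing M with
  | nil => simp
  | cons p l ih =>
    rw [List.foldl_cons]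
    obtain ⟨h1, h2, h3⟩ := ih (idealRun G o M p)
    have hrun : M ≤ idealRun G o M p ∧ (∀ z later, o.drop p = z :: later → ∀ v ∈ later,
        G.pathLen z v ≤ idealRun G o M p) ∧
        (idealRun G o M p = M ∨ ∃ z v, idealRun G o M p = G.pathLen z v) := by
      rw [idealRun]
      split
      · next h => simp [h]
      · next z later h =>
        rw [idealSource_eq hG ho h]
        obtain ⟨g1, g2, g3⟩ := le_foldl_max (G.pathLen z) later M
        refine ⟨g1, fun z' later' h' v hv => ?_, ?_⟩
        · rw [h, List.cons.injEq] at h'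
          obtain ⟨rfl, rfl⟩ := h'
          exact g2 v hv
        · rcases g3 with g3 | ⟨v, -, g3⟩
          · exact Or.inl g3
          · exact Or.inr ⟨z, v, g3⟩
    obtain ⟨g1, g2, g3⟩ := hrun
    refine ⟨g1.trans h1, ?_, ?_⟩
    · intro p' hp' z later hz v hv
      rcases List.mem_cons.1 hp' with rfl | hp'
      · exact (g2 z later hz v hv).trans h1
      · exact h2 p' hp' z later hz v hv
    · rcases h3 with h3 | h3
      · rw [h3]
        exact g3
      · exact Or.inr h3

/-- Without failures the algorithm finds the diameter. -/
theorem foldl_idealRun_eq_diam [NeZero n] {G : AdjGraph n} (hG : G.Acyclic) {o : List (Fin n)}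
    (ho : G.IsTopOrder o) :
    ((((List.range G.numNonSinks).reverse.foldl (idealRun G o) ⊥).unbotD 0 : ℕ) : ℤ) =
      G.diam := by
  obtain ⟨-, h2, h3⟩ := le_foldl_idealRun hG ho (List.range G.numNonSinks).reverse ⊥
  set M := (List.range G.numNonSinks).reverse.foldl (idealRun G o) ⊥ with hM
  refine le_antisymm ?_ (Finset.sup'_le _ _ ?_)
  · have hzero : (0 : ℤ) ≤ G.diam := by
      have hp : G.pathLen (0 : Fin n) 0 = (0 : ℕ) := by
        rw [pathLen, dist_self]
        simp
      rw [show (0 : ℤ) = G.len (0 : Fin n) 0 by rw [len_eq_of_pathLen hp]; simp]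
      exact Finset.le_sup' (fun p : Fin n × Fin n => G.len p.1 p.2) (Finset.mem_univ (0, 0))
    cases hMk : M with
    | bot => simpa using hzero
    | coe k =>
      rcases h3 with h3 | ⟨z, v, h3⟩
      · rw [h3] at hMk
        exact absurd hMk WithBot.bot_ne_coe
      · rw [hMk] at h3
        rw [WithBot.unbotD_coe, ← len_eq_of_pathLen h3.symm]
        exact Finset.le_sup' (fun p : Fin n × Fin n => G.len p.1 p.2) (Finset.mem_univ (z, v))
  · rintro ⟨i, j⟩ -
    dsimp only
    rcases len_eq_neg_one_or i j (G := G) with h | ⟨k, hk, h, hp⟩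
    · rw [h]
      omega
    rw [h, Nat.cast_le]
    rcases Nat.eq_zero_or_pos k with rfl | hk0
    · exact Nat.zero_le _
    have hi : G.out i ≠ [] := by
      cases hk with
      | nil => omega
      | cons hu _ => exact List.ne_nil_of_mem hu
    -- A pair at positive distance has a non-sink `i` at a position below `numNonSinks`, and `j`
    -- comes after it, so the pair is examined.
    have hij : j ≠ i := by
      rintro rfl
      exact hk0.ne' (hG _ _ hk)
    have hi1 : i ∈ o.take G.numNonSinks := by
      have := ho.mem i
      rw [← List.take_append_drop G.numNonSinks o, List.mem_append] at this
      exact this.resolve_right fun h => hi (ho.drop i h)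
    obtain ⟨p, hp1, hp2⟩ := List.getElem_of_mem hi1
    rw [List.length_take] at hp1
    rw [List.getElem_take] at hp2
    have hpo : p < o.length := by omega
    have hdrop : o.drop p = i :: o.drop (p + 1) := by
      rw [List.drop_eq_getElem_cons hpo, hp2]
    have hjl : j ∈ o.drop (p + 1) := by
      have hsplit : o = o.take p ++ i :: o.drop (p + 1) := by
        rw [← hdrop, List.take_append_drop]
      have hnd := ho.nodup
      rw [hsplit, List.nodup_append] at hnd
      have := ho.mem j
      rw [hsplit, List.mem_append, List.mem_cons] at this
      refine (this.resolve_left (ho.not_mem_of_hasPath hsplit hk fun h => ?_)).resolve_left hij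
      exact hnd.2.2 i h i (by simp) rfl
    have hle := h2 p (by simp; omega) i _ hdrop j hjl
    rw [hp] at hle
    cases hMk : M with
    | bot =>
      rw [hMk] at hle
      simp at hle
    | coe m =>
      rw [hMk] at hle
      rw [WithBot.unbotD_coe]
      exact WithBot.coe_le_coe.1 hle

end ideal

/-! ### The topological sort -/

theorem Timed.law_bind_of_law_pure {α β : Type} {p : Timed α} {f : α → Timed β} {a : α} {b : β}
    {k l : ℕ} (hp : p.law = PMF.pure (a, k)) (hf : (f a).law = PMF.pure (b, l)) :
    (p >>= f).law = PMF.pure (b, k + l) := by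
  rw [Timed.pure_bind_law a k p hp, hf, PMF.pure_map]

section topSort

variable {n : ℕ} {G : AdjGraph n}

theorem exists_nonSink_of_length_lt {placed : List (Fin n)}
    (h : placed.length < G.numNonSinks) : ∃ v, G.out v ≠ [] ∧ v ∉ placed := by
  classical
  by_contra! hc
  have h1 : (Finset.univ.filter fun v => G.out v ≠ []) ⊆ placed.toFinset := by
    intro v hv
    rw [List.mem_toFinset]
    exact hc v (Finset.mem_filter.1 hv).2
  have := (Finset.card_le_card h1).trans (List.toFinset_card_le placed)
  rw [numNonSinks] at h
  omega

/-- Reachability by nonempty paths is a strict order on a finite set, so `S` has a minimal element.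
For the unplaced non-sinks this is a vertex with counter `0`, as every in-neighbour is itself a
non-sink. -/
theorem exists_source_of_exists {S : Fin n → Prop} (hG : G.Acyclic) (h : ∃ v, S v) :
    ∃ v, S v ∧ ∀ u, v ∈ G.out u → ¬ S u := by
  let r : Fin n → Fin n → Prop := fun a b => ∃ k, k ≠ 0 ∧ G.HasPath a b k
  have : IsTrans (Fin n) r := ⟨fun a b c ⟨k, hk, hp⟩ ⟨l, hl, hq⟩ =>
    ⟨k + l, by omega, hp.trans hq⟩⟩
  have : Std.Irrefl r := ⟨fun a ⟨k, hk, hp⟩ => hk (hG a k hp)⟩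
  have hwf : WellFounded r := Finite.wellFounded_of_trans_of_irrefl r
  obtain ⟨v, hv, hmin⟩ := hwf.has_min {v | S v} h
  exact ⟨v, hv, fun u hu hSu => hmin u hSu ⟨1, one_ne_zero, .cons hu (.nil v)⟩⟩

/-- The invariant of the topological sort. -/
structure IsPartialOrder (G : AdjGraph n) (placed : List (Fin n)) : Prop where
  nodup : placed.Nodup
  pairwise : placed.Pairwise fun a b => a ∉ G.out b
  nonSink : ∀ v ∈ placed, G.out v ≠ []
  closed : ∀ v ∈ placed, ∀ u, v ∈ G.out u → u ∈ placed

theorem IsPartialOrder.append {placed : List (Fin n)}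
    (hp : IsPartialOrder G placed) {v : Fin n} (hv : G.out v ≠ []) (hvp : v ∉ placed)
    (hin : ∀ u, v ∈ G.out u → u ∈ placed) : IsPartialOrder G (placed ++ [v]) where
  nodup := by
    rw [List.nodup_append]
    refine ⟨hp.nodup, List.nodup_singleton v, ?_⟩
    rintro a ha b hb rfl
    rw [List.mem_singleton] at hb
    exact hvp (hb ▸ ha)
  pairwise := by
    rw [List.pairwise_append]
    refine ⟨hp.pairwise, List.pairwise_singleton _ _, ?_⟩
    intro a ha b hb hab
    rw [List.mem_singleton] at hb
    subst hb
    exact hvp (hp.closed a ha _ hab)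
  nonSink := by
    intro u hu
    rcases List.mem_append.1 hu with hu | hu
    · exact hp.nonSink u hu
    · rwa [List.mem_singleton.1 hu]
  closed := by
    intro u hu w hw
    rw [List.mem_append]
    rcases List.mem_append.1 hu with hu | hu
    · exact Or.inl (hp.closed u hu w hw)
    · rw [List.mem_singleton.1 hu] at hw
      exact Or.inl (hin w hw)

open Classical in
theorem length_filter_not_mem_append {placed : List (Fin n)} {v : Fin n} (hvp : v ∉ placed)
    (u : Fin n) : ((G.inList u).filter fun w => w ∉ placed ++ [v]).length =
      if u ∈ G.out v then ((G.inList u).filter fun w => w ∉ placed).length - 1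
      else ((G.inList u).filter fun w => w ∉ placed).length := by
  have h1 : ((G.inList u).filter fun w => w ∉ placed ++ [v]) =
      ((G.inList u).filter fun w => w ∉ placed).erase v := by
    rw [((nodup_inList u).filter _).erase_eq_filter, List.filter_filter]
    refine List.filter_congr fun w _ => ?_
    by_cases hwv : w = v <;> by_cases hw : w ∈ placed <;> simp [hwv, hw]
  rw [h1]
  split_ifs with h
  · rw [List.length_erase_of_mem]
    simp [mem_inList, h, hvp]
  · rw [List.erase_of_not_mem]
    simp [mem_inList, h]

open Classical in
theorem topSortLoop_law (hG : G.Acyclic) (r : ℕ) (placed : List (Fin n)) (cnt : Fin n → ℕ)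
    (hp : IsPartialOrder G placed)
    (hcnt : ∀ v, cnt v = ((G.inList v).filter fun w => w ∉ placed).length)
    (hr : r + placed.length = G.numNonSinks) :
    ∃ res T, (topSortLoop G r placed cnt).law = PMF.pure (res, T) ∧ T ≤ r * (2 * n) ∧
      IsPartialOrder G res ∧ res.length = G.numNonSinks := by
  induction r generalizing placed cnt with
  | zero => exact ⟨placed, 0, rfl, by omega, hp, by omega⟩
  | succ r ih =>
    rw [topSortLoop]
    split
    · next h =>
      exfalso
      obtain ⟨v, ⟨hv1, hv2⟩, hv3⟩ := exists_source_of_exists hG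
        (exists_nonSink_of_length_lt (G := G) (placed := placed) (by omega))
      rw [List.find?_eq_none] at h
      refine h v (List.mem_finRange v) (decide_eq_true ⟨hv1, hv2, ?_⟩)
      rw [hcnt, List.length_eq_zero_iff, List.filter_eq_nil_iff]
      intro u hu hup
      rw [mem_inList] at hu
      exact hv3 u hu ⟨List.ne_nil_of_mem hu, of_decide_eq_true hup⟩
    · next v h =>
      obtain ⟨hv1, hv2, hv3⟩ : G.out v ≠ [] ∧ v ∉ placed ∧ cnt v = 0 := by
        simpa using List.find?_some h
      rw [hcnt, List.length_eq_zero_iff, List.filter_eq_nil_iff] at hv3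
      have hin : ∀ u, v ∈ G.out u → u ∈ placed := by
        intro u hu
        have := hv3 u (mem_inList.2 hu)
        simpa using this
      obtain ⟨res, T, hlaw, hT, hres⟩ := ih (placed ++ [v])
        (fun u => if u ∈ G.out v then cnt u - 1 else cnt u) (hp.append hv1 hv2 hin)
        (fun u => by rw [length_filter_not_mem_append hv2, hcnt])
        (by rw [List.length_append, List.length_singleton]; omega)
      refine ⟨res, _, Timed.law_bind_of_law_pure (Timed.law_tick _) hlaw, ?_, hres⟩
      have hout : (G.out v).length ≤ n := by
        simpa using (G.nodup v).length_le_card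
      rw [add_mul]
      omega

theorem IsPartialOrder.mem_iff {placed : List (Fin n)} (hp : IsPartialOrder G placed)
    (hl : placed.length = G.numNonSinks) {v : Fin n} : v ∈ placed ↔ G.out v ≠ [] := by
  classical
  refine ⟨hp.nonSink v, fun hv => ?_⟩
  have h1 : placed.toFinset ⊆ Finset.univ.filter fun v => G.out v ≠ [] := by
    intro u hu
    simpa using hp.nonSink u (List.mem_toFinset.1 hu)
  have h2 := Finset.eq_of_subset_of_card_le h1 (by
    rw [List.toFinset_card_of_nodup hp.nodup, hl, numNonSinks])
  have h3 : v ∈ placed.toFinset := by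
    rw [h2]
    simpa using hv
  exact List.mem_toFinset.1 h3

theorem topSort_law (hG : G.Acyclic) : ∃ o T, (topSort G).law = PMF.pure (o, T) ∧
    T ≤ 2 * n + G.numNonSinks * (2 * n) ∧ G.IsTopOrder o := by
  classical
  obtain ⟨res, T, hlaw, hT, hres, hl⟩ := topSortLoop_law hG G.numNonSinks []
    (fun v => (G.inList v).length) ⟨List.nodup_nil, List.Pairwise.nil, by simp, by simp⟩
    (fun v => by simp) (by simp)
  refine ⟨_, _, Timed.law_bind_of_law_pure (Timed.law_tick _)
    (Timed.law_bind_of_law_pure hlaw (Timed.law_bind_of_law_pure (Timed.law_tick _)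
      (Timed.law_pure _))), by omega, ?_⟩
  refine ⟨?_, ?_, ?_, ?_, ?_⟩
  · rw [List.nodup_append]
    refine ⟨hres.nodup, (List.nodup_finRange n).filter _, ?_⟩
    rintro a ha b hb rfl
    exact hres.nonSink a ha (by simpa using hb)
  · intro v
    rw [List.mem_append]
    by_cases hv : G.out v = []
    · right
      simpa using hv
    · left
      exact (hres.mem_iff hl).2 hv
  · rw [List.pairwise_append]
    refine ⟨hres.pairwise, ?_, ?_⟩
    · refine List.Pairwise.imp_of_mem (R := fun _ _ => True) ?_ (List.pairwise_of_forall
        fun _ _ => trivial)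
      intro a b _ hb _
      have hb : G.out b = [] := by simpa using hb
      simp [hb]
    · intro a _ b hb
      have hb : G.out b = [] := by simpa using hb
      simp [hb]
  · rw [← hl, List.take_left]
    exact hres.nonSink
  · rw [← hl, List.drop_left]
    intro v hv
    simpa using hv

theorem isTopOrder_finRange (hG : G.Ordered) : G.IsTopOrder (List.finRange n) := by
  classical
  -- All non-sinks lie among the first `numNonSinks` numbers, and equal cardinality turns the
  -- inclusion into equality.
  have hlt : ∀ v : Fin n, G.out v ≠ [] ↔ (v : ℕ) < G.numNonSinks := by
    have h1 : (Finset.univ.filter fun v => G.out v ≠ []) ⊆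
        Finset.univ.filter fun v : Fin n => (v : ℕ) < G.numNonSinks := by
      intro v hv
      simp only [Finset.mem_filter, Finset.mem_univ, true_and] at hv ⊢
      by_contra hc
      exact hv (hG.2 v (not_lt.1 hc))
    have h2 := Finset.eq_of_subset_of_card_le h1 (by
      rw [Fin.card_filter_val_lt, ← numNonSinks]
      exact min_le_right _ _)
    intro v
    have h3 := Finset.ext_iff.1 h2 v
    simpa using h3
  refine ⟨List.nodup_finRange n, List.mem_finRange, ?_, ?_, ?_⟩
  · refine (List.pairwise_lt_finRange n).imp ?_
    intro a b hab h
    exact lt_asymm hab (hG.1 b a h)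
  · intro v hv
    rw [hlt]
    obtain ⟨i, hi, rfl⟩ := List.getElem_of_mem hv
    rw [List.length_take, List.length_finRange] at hi
    rw [List.getElem_take, List.getElem_finRange]
    simp
    omega
  · intro v hv
    by_contra hc
    rw [← ne_eq, hlt] at hc
    obtain ⟨i, hi, rfl⟩ := List.getElem_of_mem hv
    rw [List.getElem_drop, List.getElem_finRange] at hc
    simp at hc

theorem vertexOrder_law (hG : G.Acyclic) : ∃ o T, (vertexOrder G).law = PMF.pure (o, T) ∧
    T ≤ 3 * n + G.numEdges + G.numNonSinks * (2 * n) ∧ G.IsTopOrder o := by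
  rw [vertexOrder]
  split_ifs with h
  · exact ⟨_, _, Timed.law_bind_of_law_pure (Timed.law_tick _) (Timed.law_pure _), by omega,
      isTopOrder_finRange h⟩
  · obtain ⟨o, T, hlaw, hT, ho⟩ := topSort_law hG
    exact ⟨o, _, Timed.law_bind_of_law_pure (Timed.law_tick _) hlaw, by omega, ho⟩

end topSort

/-! ### The diameter algorithm -/

section diameter

variable {n : ℕ} {G : AdjGraph n}

theorem numNonSinks_le : G.numNonSinks ≤ n := by
  rw [numNonSinks]
  exact (Finset.card_le_univ _).trans_eq (Fintype.card_fin n)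

/-- Lets the final estimate absorb the linear passes over the input into the term `n̂ n`. -/
theorem numEdges_le : G.numEdges ≤ G.numNonSinks * n := by
  classical
  rw [numEdges, numNonSinks, Finset.card_filter, Finset.sum_mul]
  refine Finset.sum_le_sum fun v _ => ?_
  by_cases h : G.out v = []
  · simp [h]
  · have : (G.out v).length ≤ n := by simpa using (G.nodup v).length_le_card
    simpa [h] using this

/-- The vertex order is deterministic, so only the searches can fail: at most `n` per source and at
most `n` sources, each with probability at most `n⁻³`. -/
theorem prob_diameterAlg_le [NeZero n] (hG : G.Acyclic) :
    ((diameterAlg G).prob fun r => (r : ℤ) ≠ G.diam) ≤ ENNReal.ofReal (1 / n) := by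
  have hn : 1 ≤ n := Nat.pos_of_neZero n
  have hn0 : (0 : ℝ) < n := Nat.cast_pos.2 hn
  obtain ⟨o, T, hlaw, -, ho⟩ := vertexOrder_law hG
  have hlen : o.length ≤ n := by simpa using ho.nodup.length_le_card
  rw [diameterAlg, Timed.prob_tick_bind, Timed.prob_bind_of_law_pure hlaw]
  set l := (List.range G.numNonSinks).reverse with hl
  have hstep : ∀ (M : WithBot ℕ), ∀ p ∈ l,
      ((match o.drop p with
        | [] => pure M
        | z :: later => processSource G z later M : Timed (WithBot ℕ)).prob
          fun M' => ¬ M' = idealRun G o M p) ≤ n * failBound ^ boostCount n := by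
    intro M p _
    split
    · next h =>
      rw [Timed.prob_pure_of_not (by simp [idealRun, h])]
      exact zero_le
    · next z later h =>
      have e : idealRun G o M p = idealSource G z later M := by rw [idealRun, h]
      rw [e]
      refine (prob_processSource_le G z later M).trans ?_
      gcongr
      have := congrArg List.length h
      rw [List.length_drop, List.length_cons] at this
      omega
  have hfold := Timed.prob_foldlM_ne_le l hstep ⊥
  refine (Timed.prob_bind_le (δ := 0) hfold ?_).trans ?_
  · rintro _ rfl
    rw [Timed.prob_tick_bind, Timed.prob_pure_of_not]
    rw [ne_eq, not_not]
    exact foldl_idealRun_eq_diam hG ho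
  · rw [add_zero, hl, List.length_reverse, List.length_range]
    have h1 := failBound_pow_boostCount_le hn
    have h2 : (G.numNonSinks : ℝ≥0∞) ≤ n := Nat.cast_le.2 numNonSinks_le
    calc (G.numNonSinks : ℝ≥0∞) * (n * failBound ^ boostCount n)
        ≤ n * (n * ENNReal.ofReal (1 / n ^ 3)) := by gcongr
      _ = ENNReal.ofReal (1 / n) := by
        rw [← ENNReal.ofReal_natCast, ← ENNReal.ofReal_mul hn0.le, ← ENNReal.ofReal_mul hn0.le]
        congr 1
        field_simp

theorem timeLE_diameterAlg (hG : G.Acyclic) : (diameterAlg G).TimeLE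
    ((n + G.numEdges) + ((3 * n + G.numEdges + G.numNonSinks * (2 * n)) +
      (G.numNonSinks * (3 * n + boostCount n * (120 * Real.sqrt (n * G.numEdges) + n)) + 1))) := by
  obtain ⟨o, T, hlaw, hT, ho⟩ := vertexOrder_law hG
  have hT' : (T : ℝ) ≤ 3 * n + G.numEdges + G.numNonSinks * (2 * n) := by exact_mod_cast hT
  set S : ℝ := 3 * n + boostCount n * (120 * Real.sqrt (n * G.numEdges) + n) with hS
  have hS0 : 0 ≤ S := by positivity
  have hstep : ∀ (M : WithBot ℕ), ∀ p ∈ (List.range G.numNonSinks).reverse,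
      (match o.drop p with
        | [] => pure M
        | z :: later => processSource G z later M : Timed (WithBot ℕ)).TimeLE S := by
    intro M p _
    split
    · exact (Timed.timeLE_pure _).mono hS0
    · next z later h =>
      have hnd := (List.drop_sublist p o).nodup ho.nodup
      rw [h, List.nodup_cons] at hnd
      exact timeLE_processSource G z hnd.2 M
  have hfold := Timed.timeLE_foldlM (T := fun _ => S) _ hstep ⊥
  rw [diameterAlg]
  refine (Timed.timeLE_tick_bind (((Timed.timeLE_of_law_pure hlaw).mono hT').bind
    (T := G.numNonSinks * S + 1) fun a ha => ?_)).mono (by push_cast; rfl)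
  rw [hlaw, PMF.support_pure, Set.mem_singleton_iff] at ha
  subst ha
  refine (hfold.bind fun _ _ => (Timed.timeLE_tick 1).bind_pure fun _ => _).mono (le_of_eq ?_)
  simp

theorem expectedTime_diameterAlg_le (hG : G.Acyclic) (hm : 1 ≤ G.numEdges) :
    (diameterAlg G).expectedTime ≤ ENNReal.ofReal
      (600 * (G.numNonSinks * (n + Real.sqrt (n * G.numEdges)) * Real.log n)) := by
  refine (Timed.expectedTime_le (timeLE_diameterAlg hG)).trans (ENNReal.ofReal_le_ofReal ?_)
  have hmn : 1 ≤ G.numNonSinks * n := hm.trans numEdges_le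
  have hns : 1 ≤ G.numNonSinks := Nat.pos_of_ne_zero fun h => by simp [h] at hmn
  -- An edge joins two distinct vertices; thus `log n ≥ log 2`, and terms without a logarithm can be
  -- absorbed.
  have hn2 : 2 ≤ n := by
    obtain ⟨v, hv⟩ : ∃ v, G.out v ≠ [] := by
      by_contra! hc
      simp [numEdges, hc] at hm
    obtain ⟨u, hu⟩ := List.exists_mem_of_ne_nil _ hv
    have huv : u ≠ v := by
      rintro rfl
      exact hG.not_mem_out u hu
    have hne : (u : ℕ) ≠ v := fun h => huv (Fin.ext h)
    have := u.2
    have := v.2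
    omega
  have hm' : (G.numEdges : ℝ) ≤ G.numNonSinks * n := by exact_mod_cast numEdges_le (G := G)
  have hns' : (1 : ℝ) ≤ G.numNonSinks := by exact_mod_cast hns
  have hn' : (2 : ℝ) ≤ n := by exact_mod_cast hn2
  set s : ℝ := (G.numNonSinks : ℝ)
  set q := Real.sqrt (n * G.numEdges)
  have hq : 0 ≤ q := Real.sqrt_nonneg _
  have hlog : Real.log 2 ≤ Real.log n := Real.log_le_log two_pos hn'
  have hl1 := Real.log_two_gt_d9
  -- Rounding up costs at most `1 ≤ log₂ n`, which turns the factor `2` into `3`; then `3 / log 2 <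
  -- 9/2`, and `9/2 * 120 = 540` leads to the constant `600`.
  have hk : (boostCount n : ℝ) ≤ 3 / Real.log 2 * Real.log n := by
    have h1 : (1 : ℝ) ≤ Real.logb 2 n := by
      rw [Real.le_logb_iff_rpow_le one_lt_two (by linarith), Real.rpow_one]
      exact hn'
    have h2 : (boostCount n : ℝ) ≤ 2 * Real.logb 2 n + 1 :=
      (Nat.ceil_lt_add_one (by linarith)).le
    calc (boostCount n : ℝ) ≤ 3 * Real.logb 2 n := by linarith
      _ = 3 / Real.log 2 * Real.log n := by rw [Real.logb]; ring
  have hk' : (boostCount n : ℝ) ≤ 9 / 2 * Real.log n := by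
    refine hk.trans (mul_le_mul_of_nonneg_right ?_ (by linarith))
    rw [div_le_iff₀ (by linarith)]
    linarith
  have hsn : (n : ℝ) ≤ s * n := by nlinarith
  have hsn2 : s * n ≤ 2 * (s * n * Real.log n) := by
    have : 0 ≤ s * n := by positivity
    nlinarith
  have h3 : s * (boostCount n * (120 * q + n)) ≤ s * (9 / 2 * Real.log n * (120 * q + n)) := by
    gcongr
  have h4 : 0 ≤ s * q * Real.log n := by
    have : 0 ≤ Real.log n := by linarith
    positivity
  nlinarith

end diameter

end DagDiameter

end

theorem theorem6 :
    ∃ C : ℝ, 0 < C ∧ ∀ (n : ℕ) [NeZero n] (G : DagDiameter.AdjGraph n), G.Acyclic →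
      (DagDiameter.diameterAlg G).prob (fun r => (r : ℤ) ≠ G.diam) ≤ ENNReal.ofReal (C / n) ∧
      (1 ≤ G.numEdges →
        (DagDiameter.diameterAlg G).expectedTime ≤
          ENNReal.ofReal
            (C * (G.numNonSinks * (n + Real.sqrt (n * G.numEdges)) * Real.log n))) := by
  -- The running time dictates `600`; the error bound holds already with constant `1`.
  refine ⟨600, by norm_num, fun n _ G hG =>
    ⟨(DagDiameter.prob_diameterAlg_le hG).trans (ENNReal.ofReal_le_ofReal ?_),
      DagDiameter.expectedTime_diameterAlg_le hG⟩⟩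
  gcongr
  norm_num
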